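/- Let $G=(V,(c_{xy})_{x,y\in V})$ be a finite weighted graph with at least two vertices and symmetric conductances $c_{xy}=c_{yx}\ge 0$, $c_{xx}=0$, which is connected (through the edges $xy$ with $c_{xy}>0$), and let ${\rm diam}(G)$ be its diameter in the graph distance. For positive site weights $\alpha=(\alpha_x)_{x\in V}$ and $k\ge 1$, let $\Xi_k=\{\eta\in\mathbb{N}_0^V:\sum_{x}\eta_x=k\}$, and let $$L_{G,\alpha,k}f(\eta)=\sum_{x,y\in V}c_{xy}\,\eta_x(\alpha_y+\eta_y)\bigl(f(\eta-\delta_x+\delta_y)-f(\eta)\bigr),\qquad f\in\mathbb{R}^{\Xi_k},\ \eta\in\Xi_k,$$ be the generator of the symmetric inclusion process (SIP) with $k$ particles. Let ${\rm gap}_k(G,\alpha)$ be the smallest non-zero eigenvalue of $-L_{G,\alpha,k}$, and ${\rm gap}_{\rm SIP}(G,\alpha)=\inf_{k\ge 2}{\rm gap}_k(G,\alpha)$. Set $$\alpha_{\min}=\min_{x\in V}\alpha_x,\quad \alpha_{\max}=\max_{x\in V}\alpha_x,\quad \alpha_{\rm ratio}=\frac{\alpha_{\min}}{\alpha_{\max}},\quad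 c_{\min}=\min_{x,y\in V:\,c_{xy}>0}c_{xy}.$$ Then, for all such $G$ and $\alpha$, $$\alpha_{\min}\left\{\frac{1}{21}\,\frac{\alpha_{\rm ratio}}{6^{\alpha_{\min}/\alpha_{\rm ratio}}}\,\frac{c_{\min}}{|V|^2\,{\rm diam}(G)}\right\}\le {\rm gap}_{\rm SIP}(G,\alpha).$$ In particular, for $\alpha_{\min}<1$ the gap depends linearly on $\alpha_{\min}$: for every such $G$ and all positive weights $\hat\alpha=(\hat\alpha_x)_{x\in V}$, there are constants $C,C'>0$ depending only on $G$ and $\hat\alpha$ such that, for all positive site weights $\alpha$ with $\alpha_{\min}\in(0,1)$ and $\alpha/\alpha_{\min}=\hat\alpha$, $$C\,\alpha_{\min}\le{\rm gap}_{\rm SIP}(G,\alpha)\le C'\,\alpha_{\min}.$$ -/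

import Mathlib

noncomputable section

/-- A finite weighted graph on the vertex set `V`: symmetric non-negative conductances,
with the convention that the diagonal ones vanish. -/
structure WeightedGraph (V : Type*) where
  /-- the conductance of a pair of sites -/
  c : V → V → ℝ
  symm : ∀ x y, c x y = c y x
  nonneg : ∀ x y, 0 ≤ c x y
  self : ∀ x, c x x = 0

/-- The underlying undirected graph: the edges are the pairs with positive conductance. -/
def WeightedGraph.toSimpleGraph {V : Type*} (G : WeightedGraph V) : SimpleGraph V where
  Adj x y := 0 < G.c x y
  symm := ⟨fun x y h => by rw [G.symm y x]; exact h⟩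
  loopless := ⟨fun x h => by rw [G.self x] at h; exact lt_irrefl _ h⟩

/-- The smallest positive conductance. (For a finite connected graph with at least two vertices
this is the infimum of a finite non-empty family, hence a minimum.) -/
def WeightedGraph.cMin {V : Type*} (G : WeightedGraph V) : ℝ :=
  ⨅ e : {e : V × V // 0 < G.c e.1 e.2}, G.c e.1.1 e.1.2

/-- `min_x α_x`, for `V` finite and non-empty. -/
def siteMin {V : Type*} (α : V → ℝ) : ℝ := ⨅ x, α x

/-- `max_x α_x`, for `V` finite and non-empty. -/
def siteMax {V : Type*} (α : V → ℝ) : ℝ := ⨆ x, α x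

/-- `α_ratio = α_min / α_max`. -/
def siteRatio {V : Type*} (α : V → ℝ) : ℝ := siteMin α / siteMax α

/-- The configuration space of `k` particles on `V`. -/
abbrev Config (V : Type*) [Fintype V] (k : ℕ) : Type _ := {η : V → ℕ // ∑ x, η x = k}

/-- The configuration `η - δ_x + δ_y`, obtained from `η` by moving a particle from `x` to `y`;
it is `η` itself if there is no particle at `x`. -/
def Config.move {V : Type*} [Fintype V] [DecidableEq V] {k : ℕ} (η : Config V k) (x y : V) :
    Config V k :=
  if h : 0 < η.1 x then
    ⟨η.1 - Pi.single x 1 + Pi.single y 1, by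
      have hle : Pi.single x 1 ≤ η.1 := by
        intro z
        by_cases hz : z = x
        · subst hz; simpa using Nat.succ_le_of_lt h
        · simp [Pi.single_eq_of_ne hz]
      have h1 : ∑ z, (η.1 - Pi.single x 1 + Pi.single x 1 : V → ℕ) z = k := by
        rw [tsub_add_cancel_of_le hle]; exact η.2
      simp only [Pi.add_apply, Finset.sum_add_distrib, Finset.sum_pi_single',
        Finset.mem_univ, if_true] at h1 ⊢
      exact h1⟩
  else η

/-- The generator of the symmetric inclusion process with `k` particles:
`(L f)(η) = ∑_{x,y} c_{xy} η_x (α_y + η_y) (f(η - δ_x + δ_y) - f(η))`. -/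
def sipGenerator {V : Type*} [Fintype V] [DecidableEq V] (G : WeightedGraph V) (α : V → ℝ)
    (k : ℕ) : Module.End ℝ (Config V k → ℝ) where
  toFun f := fun η =>
    ∑ x, ∑ y, G.c x y * (η.1 x : ℝ) * (α y + (η.1 y : ℝ)) * (f (η.move x y) - f η)
  map_add' f g := by
    funext η
    simp only [Pi.add_apply, ← Finset.sum_add_distrib]
    exact Finset.sum_congr rfl fun x _ => Finset.sum_congr rfl fun y _ => by ring
  map_smul' a f := by
    funext η
    simp only [Pi.smul_apply, smul_eq_mul, RingHom.id_apply, Finset.mul_sum]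
    exact Finset.sum_congr rfl fun x _ => Finset.sum_congr rfl fun y _ => by ring

/-- The spectral gap of the `k`-particle process: the smallest non-zero eigenvalue of the
negative of its generator. -/
def sipGapK {V : Type*} [Fintype V] [DecidableEq V] (G : WeightedGraph V) (α : V → ℝ)
    (k : ℕ) : ℝ :=
  sInf {l : ℝ | l ≠ 0 ∧ Module.End.HasEigenvalue (-sipGenerator G α k) l}

/-- The spectral gap of the symmetric inclusion process: the infimum over `k ≥ 2` of the
`k`-particle gaps. -/
def sipGap {V : Type*} [Fintype V] [DecidableEq V] (G : WeightedGraph V) (α : V → ℝ) : ℝ :=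
  ⨅ k : {k : ℕ // 2 ≤ k}, sipGapK G α k

end

/-! ### Reversible weights, the annihilation operator and the complete graph. -/

noncomputable section PolyaWeight

set_option linter.unusedSectionVars false

/-! The lower bound comes from a stronger inequality, with `siteRatio α` in place of its product
with `1/21` and the inverse power of 6. The argument strips particles off an eigenfunction and then
compares Dirichlet forms.

The operator `annihilate` maps functions of `k + 1` particles to functions of `k` particles and
commutes with the generator (`confGenerator_annihilate`). So an eigenfunction with non-zero
eigenvalue can be annihilated repeatedly, keeping its eigenvalue, until it lies in the kernel; zero
particles are never reached, as the generator vanishes there. On the kernel, `sum_pairForm_add` says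
that the Dirichlet form of the complete graph is exactly `M = (k+1)(∑ a + k)` times the squared
norm.

It remains to bound an exchange between distant sites `x`, `y` by exchanges along edges, losing only
`M` times a constant free of `k`: this `M` then cancels. To this end each site is split into a core
of common weight `β` and a rest. Merging recovers the original measure, and an exchange with `x` is
proportional to one with its core (`coreForm_merge`). Cores have equal weights, so swapping the
cores of two neighbours preserves the measure and carries the core of `x` one step towards `y`. The
error of a swap is small in norm by the two-site Poincaré inequality (`normSq_coreSwap_sub_le`), and
the identity on the complete graph turns norm into Dirichlet form at the price `M` (`coreForm_le`).
Weighted telescoping along a geodesic costs only a factor `diam`.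

For the upper bound, an eigenfunction `g` of the one-particle walk lifts to `∑ v, η v * g v` with
the same eigenvalue, and walk eigenvalues are linear in the site weights. -/

/-- The weight `a (a+1) ⋯ (a+n-1) / n!`. -/
def polyaFactor (a : ℝ) (n : ℕ) : ℝ := ∏ i ∈ Finset.range n, (a + i) / (i + 1)

theorem polyaFactor_succ (a : ℝ) (n : ℕ) :
    polyaFactor a (n + 1) * ((n : ℝ) + 1) = polyaFactor a n * (a + n) := by
  unfold polyaFactor
  rw [Finset.prod_range_succ]
  have : (n : ℝ) + 1 ≠ 0 := by positivity
  field_simp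

theorem polyaFactor_nonneg {a : ℝ} (ha : 0 ≤ a) (n : ℕ) : 0 ≤ polyaFactor a n :=
  Finset.prod_nonneg fun _ _ => by positivity

theorem polyaFactor_pos {a : ℝ} (ha : 0 < a) (n : ℕ) : 0 < polyaFactor a n :=
  Finset.prod_pos fun _ _ => by positivity

variable {W : Type*} [Fintype W] [DecidableEq W]

/-- The (unnormalised) reversible measure of the inclusion process. -/
def polyaWeight (a : W → ℝ) (η : W → ℕ) : ℝ := ∏ x, polyaFactor (a x) (η x)

/-- The configurations with `k` particles. -/
def confs (W : Type*) [Fintype W] [DecidableEq W] (k : ℕ) : Finset (W → ℕ) :=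
  Finset.piAntidiag Finset.univ k

/-- A single particle at `x`. -/
abbrev unitAt (x : W) : W → ℕ := Pi.single x 1

theorem mem_confs {k : ℕ} {η : W → ℕ} : η ∈ confs W k ↔ ∑ x, η x = k := by
  simp [confs]

theorem sum_add_unitAt (η : W → ℕ) (x : W) : ∑ z, (η + unitAt x) z = ∑ z, η z + 1 := by
  simp [Finset.sum_add_distrib]

theorem add_unitAt_mem {k : ℕ} {η : W → ℕ} (h : η ∈ confs W k) (x : W) :
    η + unitAt x ∈ confs W (k + 1) := by
  rw [mem_confs] at *
  rw [sum_add_unitAt, h]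

theorem sub_unitAt_add {η : W → ℕ} {x : W} (h : η x ≠ 0) : η - unitAt x + unitAt x = η := by
  funext z
  by_cases hz : z = x
  · subst hz; simp; omega
  · simp [hz]

theorem sub_unitAt_mem {k : ℕ} {η : W → ℕ} (h : η ∈ confs W (k + 1)) {x : W} (hx : η x ≠ 0) :
    η - unitAt x ∈ confs W k := by
  rw [mem_confs] at *
  have := sum_add_unitAt (η - unitAt x) x
  rw [sub_unitAt_add hx] at this
  omega

theorem polyaWeight_nonneg {a : W → ℝ} (ha : ∀ x, 0 ≤ a x) (η : W → ℕ) : 0 ≤ polyaWeight a η :=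
  Finset.prod_nonneg fun x _ => polyaFactor_nonneg (ha x) _

theorem polyaWeight_pos {a : W → ℝ} (ha : ∀ x, 0 < a x) (η : W → ℕ) : 0 < polyaWeight a η :=
  Finset.prod_pos fun x _ => polyaFactor_pos (ha x) _

theorem polyaWeight_add_unitAt (a : W → ℝ) (η : W → ℕ) (x : W) :
    polyaWeight a (η + unitAt x) * ((η x : ℝ) + 1) = polyaWeight a η * (a x + η x) := by
  unfold polyaWeight
  rw [← Finset.mul_prod_erase _ _ (Finset.mem_univ x),
    ← Finset.mul_prod_erase _ (fun z => polyaFactor (a z) (η z)) (Finset.mem_univ x)]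
  have h : ∏ z ∈ Finset.univ.erase x, polyaFactor (a z) ((η + unitAt x) z) =
      ∏ z ∈ Finset.univ.erase x, polyaFactor (a z) (η z) := by
    refine Finset.prod_congr rfl fun z hz => ?_
    simp [Finset.ne_of_mem_erase hz]
  rw [h]
  have := polyaFactor_succ (a x) (η x)
  simp only [Pi.add_apply, Pi.single_eq_same]
  linear_combination (∏ z ∈ Finset.univ.erase x, polyaFactor (a z) (η z)) * this

/-- The size-bias identity. -/
theorem sum_confs_mul_coord (a : W → ℝ) (k : ℕ) (x : W) (h : (W → ℕ) → ℝ) :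
    ∑ η ∈ confs W (k + 1), polyaWeight a η * η x * h η =
      ∑ ξ ∈ confs W k, polyaWeight a ξ * (a x + ξ x) * h (ξ + unitAt x) := by
  symm
  -- Configurations with no particle at `x` are not of the form `ξ + unitAt x`, but their terms
  -- vanish.
  refine Finset.sum_bij_ne_zero (fun ξ _ _ => ξ + unitAt x) (fun ξ hξ _ => add_unitAt_mem hξ x)
    (fun _ _ _ _ _ _ h => add_right_cancel h) (fun η hη h0 => ?_) (fun ξ _ _ => ?_)
  · have hx : η x ≠ 0 := fun hx => h0 (by simp [hx])
    refine ⟨η - unitAt x, sub_unitAt_mem hη hx, ?_, sub_unitAt_add hx⟩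
    rw [← polyaWeight_add_unitAt, sub_unitAt_add hx]
    convert h0 using 3
    simp; norm_cast; omega
  · rw [← polyaWeight_add_unitAt]; simp

/-- The squared norm of a function on the configurations with `k` particles. -/
def normSq (a : W → ℝ) (k : ℕ) (f : (W → ℕ) → ℝ) : ℝ :=
  ∑ η ∈ confs W k, polyaWeight a η * f η ^ 2

/-- The Dirichlet form of the exchanges between `x` and `y`, for `k + 1` particles. -/
def pairForm (a : W → ℝ) (k : ℕ) (x y : W) (f : (W → ℕ) → ℝ) : ℝ :=
  ∑ ξ ∈ confs W k, polyaWeight a ξ * (a x + ξ x) * (a y + ξ y) *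
    (f (ξ + unitAt x) - f (ξ + unitAt y)) ^ 2

/-- The annihilation operator. -/
def annihilate (a : W → ℝ) (f : (W → ℕ) → ℝ) : (W → ℕ) → ℝ :=
  fun ξ => ∑ y, (a y + ξ y) * f (ξ + unitAt y)

theorem normSq_nonneg {a : W → ℝ} (ha : ∀ x, 0 ≤ a x) (k : ℕ) (f : (W → ℕ) → ℝ) :
    0 ≤ normSq a k f :=
  Finset.sum_nonneg fun η _ => mul_nonneg (polyaWeight_nonneg ha η) (sq_nonneg _)

theorem pairForm_nonneg {a : W → ℝ} (ha : ∀ x, 0 ≤ a x) (k : ℕ) (x y : W) (f : (W → ℕ) → ℝ) :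
    0 ≤ pairForm a k x y f :=
  Finset.sum_nonneg fun η _ => by
    have := polyaWeight_nonneg ha η
    have := ha x
    have := ha y
    positivity

theorem pairForm_comm (a : W → ℝ) (k : ℕ) (x y : W) (f : (W → ℕ) → ℝ) :
    pairForm a k x y f = pairForm a k y x f :=
  Finset.sum_congr rfl fun ξ _ => by ring

theorem pairForm_self (a : W → ℝ) (k : ℕ) (x : W) (f : (W → ℕ) → ℝ) :
    pairForm a k x x f = 0 :=
  Finset.sum_eq_zero fun ξ _ => by ring

theorem sum_confs_total (a : W → ℝ) (k : ℕ) (h : (W → ℕ) → ℝ) :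
    ((k : ℝ) + 1) * ∑ η ∈ confs W (k + 1), polyaWeight a η * h η =
      ∑ x, ∑ ξ ∈ confs W k, polyaWeight a ξ * (a x + ξ x) * h (ξ + unitAt x) := by
  simp_rw [← sum_confs_mul_coord]
  rw [Finset.sum_comm, Finset.mul_sum]
  refine Finset.sum_congr rfl fun η hη => ?_
  have : ∑ x, (η x : ℝ) = k + 1 := by exact_mod_cast mem_confs.1 hη
  rw [← Finset.sum_mul, ← Finset.mul_sum, this]
  ring

/-- In particular annihilation preserves mean zero, which lets the two-site Poincaré inequality be
proved by induction on the number of particles. -/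
theorem sum_annihilate (a : W → ℝ) (k : ℕ) (h : (W → ℕ) → ℝ) :
    ∑ ξ ∈ confs W k, polyaWeight a ξ * annihilate a h ξ =
      ((k : ℝ) + 1) * ∑ η ∈ confs W (k + 1), polyaWeight a η * h η := by
  rw [sum_confs_total, Finset.sum_comm]
  refine Finset.sum_congr rfl fun ξ _ => ?_
  rw [annihilate, Finset.mul_sum]
  exact Finset.sum_congr rfl fun x _ => by ring

theorem sum_sum_mul_sub_sq (b g : W → ℝ) :
    ∑ x, ∑ y, b x * b y * (g x - g y) ^ 2 =
      2 * ((∑ x, b x) * ∑ x, b x * g x ^ 2 - (∑ x, b x * g x) ^ 2) := by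
  have h : ∀ x y, b x * b y * (g x - g y) ^ 2 =
      (b x * g x ^ 2) * b y + b x * (b y * g y ^ 2) - 2 * ((b x * g x) * (b y * g y)) :=
    fun x y => by ring
  simp_rw [h, Finset.sum_sub_distrib, Finset.sum_add_distrib, ← Finset.mul_sum, ← Finset.sum_mul]
  ring

/-- The spectral identity for the complete graph. -/
theorem sum_pairForm_add (a : W → ℝ) (k : ℕ) (f : (W → ℕ) → ℝ) :
    (∑ x, ∑ y, pairForm a k x y f) / 2 + normSq a k (annihilate a f) =
      ((k : ℝ) + 1) * (∑ x, a x + k) * normSq a (k + 1) f := by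
  have h1 : ∑ x, ∑ y, pairForm a k x y f = ∑ ξ ∈ confs W k, polyaWeight a ξ *
      ∑ x, ∑ y, (a x + ξ x) * (a y + ξ y) * (f (ξ + unitAt x) - f (ξ + unitAt y)) ^ 2 := by
    unfold pairForm
    simp_rw [Finset.mul_sum]
    rw [Finset.sum_congr rfl fun x _ => Finset.sum_comm, Finset.sum_comm]
    exact Finset.sum_congr rfl fun ξ _ => Finset.sum_congr rfl fun x _ =>
      Finset.sum_congr rfl fun y _ => by ring
  have h2 := sum_confs_total a k (fun η => f η ^ 2)
  rw [Finset.sum_comm] at h2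
  rw [h1, mul_right_comm]
  unfold normSq
  rw [h2, Finset.sum_div, ← Finset.sum_add_distrib, Finset.sum_mul]
  refine Finset.sum_congr rfl fun ξ hξ => ?_
  rw [sum_sum_mul_sub_sq (fun x => a x + (ξ x : ℝ)) fun x => f (ξ + unitAt x)]
  have h3 : ∑ x, (a x + (ξ x : ℝ)) = ∑ x, a x + k := by
    rw [Finset.sum_add_distrib]; congr 1; exact_mod_cast mem_confs.1 hξ
  have h4 : ∑ x, polyaWeight a ξ * (a x + ξ x) * f (ξ + unitAt x) ^ 2 =
      polyaWeight a ξ * ∑ x, (a x + (ξ x : ℝ)) * f (ξ + unitAt x) ^ 2 := by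
    rw [Finset.mul_sum]; exact Finset.sum_congr rfl fun x _ => by ring
  rw [h3, h4, annihilate]
  ring

/-- The Poincaré inequality for two sites. -/
theorem bool_poincare {a : Bool → ℝ} (ha : ∀ x, 0 < a x) (m : ℕ) (f : (Bool → ℕ) → ℝ)
    (hf : ∑ η ∈ confs Bool (m + 1), polyaWeight a η * f η = 0) :
    (a true + a false) * normSq a (m + 1) f ≤ pairForm a m true false f := by
  induction m generalizing f with
  | zero =>
    have h1 := sum_pairForm_add a 0 f
    have h2 : confs Bool 0 = {0} := by simp [confs]
    have h3 := sum_annihilate a 0 f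
    rw [hf, h2, Finset.sum_singleton] at h3
    have h4 : normSq a 0 (annihilate a f) = 0 := by
      have := polyaWeight_pos ha 0
      have h5 : annihilate a f 0 = 0 := by
        rcases mul_eq_zero.1 (h3.trans (mul_zero _)) with h | h
        · exact absurd h this.ne'
        · exact h
      simp [normSq, h2, h5]
    rw [h4] at h1
    simp only [Fintype.sum_bool, pairForm_self, pairForm_comm a 0 false true] at h1
    push_cast at h1
    linarith
  | succ m ih =>
    have h1 := sum_pairForm_add a (m + 1) f
    have h2 := ih (annihilate a f) (by rw [sum_annihilate, hf, mul_zero])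
    -- Differences of `annihilate a f` are weighted sums of differences of `f` (`e5`).
    -- Cauchy–Schwarz bounds their squares, and the size-bias identity reassembles the form with one
    -- more particle (`e3`).
    have h3 : pairForm a m true false (annihilate a f) ≤
        (a true + a false + m + 2) * (m + 1) * pairForm a (m + 1) true false f := by
      set d : (Bool → ℕ) → ℝ := fun ζ => f (ζ + unitAt true) - f (ζ + unitAt false) with hd
      have e1 := sum_confs_mul_coord a m true
        (fun η => (a true + η true) * (a false + η false) * d η ^ 2)
      have e2 := sum_confs_mul_coord a m false
        (fun η => (a true + η true) * (a false + η false) * d η ^ 2)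
      have e3 : (m + 1) * pairForm a (m + 1) true false f =
          ∑ ξ ∈ confs Bool m, polyaWeight a ξ * (a true + ξ true) * (a false + ξ false) *
            ((a true + ξ true + 1) * d (ξ + unitAt true) ^ 2 +
              (a false + ξ false + 1) * d (ξ + unitAt false) ^ 2) := by
        have e4 : (m + 1) * pairForm a (m + 1) true false f =
            ∑ η ∈ confs Bool (m + 1), polyaWeight a η * η true *
              ((a true + η true) * (a false + η false) * d η ^ 2) +
            ∑ η ∈ confs Bool (m + 1), polyaWeight a η * η false *
              ((a true + η true) * (a false + η false) * d η ^ 2) := by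
          rw [pairForm, Finset.mul_sum, ← Finset.sum_add_distrib]
          refine Finset.sum_congr rfl fun η hη => ?_
          have : (η true : ℝ) + η false = m + 1 := by
            have := mem_confs.1 hη
            rw [Fintype.sum_bool] at this
            exact_mod_cast this
          rw [← this, hd]; ring
        rw [e4, e1, e2, ← Finset.sum_add_distrib]
        refine Finset.sum_congr rfl fun ξ _ => ?_
        simp
        ring
      rw [mul_assoc, e3, pairForm, Finset.mul_sum]
      refine Finset.sum_le_sum fun ξ hξ => ?_
      have hm : (ξ true : ℝ) + ξ false = m := by
        have := mem_confs.1 hξ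
        rw [Fintype.sum_bool] at this
        exact_mod_cast this
      have e5 : annihilate a f (ξ + unitAt true) - annihilate a f (ξ + unitAt false) =
          (a true + ξ true + 1) * d (ξ + unitAt true) +
            (a false + ξ false + 1) * d (ξ + unitAt false) := by
        simp only [annihilate, Fintype.sum_bool, hd, Pi.add_apply, Pi.single_eq_same, ne_eq,
          Bool.false_eq_true, Bool.true_eq_false, not_false_eq_true, Pi.single_eq_of_ne,
          Nat.cast_add, Nat.cast_one, Nat.cast_zero, add_right_comm ξ (unitAt false) (unitAt true)]
        ring
      rw [e5, ← hm]
      have p1 : 0 < a true + ξ true := by have := ha true; positivity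
      have p2 : 0 < a false + ξ false := by have := ha false; positivity
      have p3 := polyaWeight_pos ha ξ
      generalize d (ξ + unitAt true) = u
      generalize d (ξ + unitAt false) = v
      set P := a true + (ξ true : ℝ)
      set Q := a false + (ξ false : ℝ)
      have key : ((P + 1) * u + (Q + 1) * v) ^ 2 ≤
          (P + Q + 2) * ((P + 1) * u ^ 2 + (Q + 1) * v ^ 2) := by
        have : 0 ≤ (P + 1) * (Q + 1) * (u - v) ^ 2 := by positivity
        linarith
      calc polyaWeight a ξ * P * Q * ((P + 1) * u + (Q + 1) * v) ^ 2
          ≤ polyaWeight a ξ * P * Q * ((P + Q + 2) * ((P + 1) * u ^ 2 + (Q + 1) * v ^ 2)) := by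
            gcongr
        _ = _ := by simp only [P, Q]; ring
    simp only [Fintype.sum_bool, pairForm_self, pairForm_comm a (m + 1) false true] at h1
    push_cast at h1
    have hA : 0 < a true + a false := add_pos (ha _) (ha _)
    set A := a true + a false
    set D := pairForm a (m + 1) true false f
    -- The induction closes without loss because `A + (A + m + 2)(m + 1) = (m + 2)(A + m + 1)`.
    have hpos : 0 < ((m : ℝ) + 1 + 1) * (A + (m + 1)) := by positivity
    refine le_of_mul_le_mul_left ?_ hpos
    nlinarith [h1, h2, h3]

end PolyaWeight

/-! ### Conditional Poincaré inequality for a pair of sites. -/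

noncomputable section Resampling

set_option linter.unusedSectionVars false

theorem sub_unitAt_of_add {W : Type*} [DecidableEq W] (ξ : W → ℕ) (x : W) :
    ξ + unitAt x - unitAt x = ξ := add_tsub_cancel_right _ _

theorem pairForm_eq_sum {W : Type*} [Fintype W] [DecidableEq W] (a : W → ℝ) (k : ℕ) {x y : W}
    (hxy : x ≠ y) (f : (W → ℕ) → ℝ) :
    pairForm a k x y f = ∑ η ∈ confs W (k + 1), polyaWeight a η *
      (η x * ((a y + η y) * (f η - f (η - unitAt x + unitAt y)) ^ 2)) := by
  simp_rw [← mul_assoc (polyaWeight a _)]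
  rw [sum_confs_mul_coord, pairForm]
  refine Finset.sum_congr rfl fun ξ _ => ?_
  rw [sub_unitAt_of_add]
  simp [hxy.symm]
  ring

/-- The total weight of two sites with `m` particles. -/
def boolMass (b : Bool → ℝ) (m : ℕ) : ℝ := ∑ p ∈ confs Bool m, polyaWeight b p

theorem boolMass_pos {b : Bool → ℝ} (hb : ∀ i, 0 < b i) (m : ℕ) : 0 < boolMass b m :=
  Finset.sum_pos (fun p _ => polyaWeight_pos hb p)
    ⟨fun i => if i then m else 0, by rw [mem_confs]; simp⟩

/-- The Poincaré inequality for two sites, for an arbitrary number of particles. -/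
theorem bool_poincare_sub_mean {b : Bool → ℝ} (hb : ∀ i, 0 < b i) (m : ℕ) (g : (Bool → ℕ) → ℝ)
    (c : ℝ) (hc : ∑ p ∈ confs Bool m, polyaWeight b p * g p = c * boolMass b m) :
    (b true + b false) * ∑ p ∈ confs Bool m, polyaWeight b p * (g p - c) ^ 2 ≤
      ∑ p ∈ confs Bool m, polyaWeight b p * (p true * ((b false + p false) *
        (g p - g (p - unitAt true + unitAt false)) ^ 2)) := by
  cases m with
  | zero =>
    have h : confs Bool 0 = {0} := by simp [confs]
    have hw := polyaWeight_pos hb 0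
    rw [boolMass, h, Finset.sum_singleton, Finset.sum_singleton] at hc
    have : g 0 = c := mul_left_cancel₀ hw.ne' (by linarith)
    simp [h, this]
  | succ m =>
    have h := bool_poincare hb m (fun p => g p - c) (by
      simp_rw [mul_sub, Finset.sum_sub_distrib, hc, ← Finset.sum_mul]
      rw [boolMass]; ring)
    rw [pairForm_eq_sum _ _ (by decide)] at h
    simpa [normSq] using h

variable {V : Type*} [Fintype V] [DecidableEq V]

/-- The configuration `η` with the occupation numbers of `x` and `z` replaced by those of `p`. -/
def setPair (x z : V) (η : V → ℕ) (p : Bool → ℕ) : V → ℕ :=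
  Function.update (Function.update η x (p true)) z (p false)

/-- The values of `g` at `x` and `z`. -/
def getPair {β : Type*} (x z : V) (g : V → β) : Bool → β := fun i => if i then g x else g z

variable {x z : V}

theorem setPair_left (hxz : x ≠ z) (η : V → ℕ) (p : Bool → ℕ) : setPair x z η p x = p true := by
  simp [setPair, hxz]

theorem setPair_right (η : V → ℕ) (p : Bool → ℕ) : setPair x z η p z = p false := by
  simp [setPair]

theorem setPair_of_ne {v : V} (hx : v ≠ x) (hz : v ≠ z) (η : V → ℕ) (p : Bool → ℕ) :
    setPair x z η p v = η v := by
  simp [setPair, hx, hz]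

theorem sum_split (hxz : x ≠ z) (η : V → ℕ) :
    ∑ v, η v = η x + (η z + ∑ v ∈ (Finset.univ.erase x).erase z, η v) := by
  rw [Finset.add_sum_erase _ _ (by simp [hxz.symm]), Finset.add_sum_erase _ _ (Finset.mem_univ x)]

theorem polyaWeight_split (hxz : x ≠ z) (a : V → ℝ) (η : V → ℕ) :
    polyaWeight a η = polyaFactor (a x) (η x) * (polyaFactor (a z) (η z) *
      ∏ v ∈ (Finset.univ.erase x).erase z, polyaFactor (a v) (η v)) := by
  rw [Finset.mul_prod_erase _ (fun v => polyaFactor (a v) (η v)) (by simp [hxz.symm]),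
    Finset.mul_prod_erase _ (fun v => polyaFactor (a v) (η v)) (Finset.mem_univ x), polyaWeight]

theorem setPair_mem (hxz : x ≠ z) {k : ℕ} {η : V → ℕ} (hη : η ∈ confs V k) {p : Bool → ℕ}
    (hp : p ∈ confs Bool (η x + η z)) : setPair x z η p ∈ confs V k := by
  rw [mem_confs, sum_split hxz] at *
  rw [Fintype.sum_bool] at hp
  have : ∑ v ∈ (Finset.univ.erase x).erase z, setPair x z η p v =
      ∑ v ∈ (Finset.univ.erase x).erase z, η v :=
    Finset.sum_congr rfl fun v hv => by
      simp only [Finset.mem_erase] at hv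
      exact setPair_of_ne hv.2.1 hv.1 _ _
  rw [this, setPair_left hxz, setPair_right]
  omega

theorem polyaWeight_setPair (hxz : x ≠ z) (a : V → ℝ) (η : V → ℕ) (p : Bool → ℕ) :
    polyaWeight a (setPair x z η p) * polyaWeight (getPair x z a) (getPair x z η) =
      polyaWeight a η * polyaWeight (getPair x z a) p := by
  have : ∏ v ∈ (Finset.univ.erase x).erase z, polyaFactor (a v) (setPair x z η p v) =
      ∏ v ∈ (Finset.univ.erase x).erase z, polyaFactor (a v) (η v) :=
    Finset.prod_congr rfl fun v hv => by
      simp only [Finset.mem_erase] at hv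
      rw [setPair_of_ne hv.2.1 hv.1 _ _]
  rw [polyaWeight_split hxz, polyaWeight_split hxz a η, this, setPair_left hxz, setPair_right]
  simp only [polyaWeight, Fintype.prod_bool, getPair]
  simp
  ring

theorem setPair_setPair (hxz : x ≠ z) {η : V → ℕ} (p : Bool → ℕ) :
    setPair x z (setPair x z η p) (getPair x z η) = η := by
  funext v
  by_cases hz : v = z
  · subst hz; rw [setPair_right]; rfl
  by_cases hx : v = x
  · subst hx; rw [setPair_left hxz]; rfl
  rw [setPair_of_ne hx hz, setPair_of_ne hx hz]

theorem getPair_setPair (hxz : x ≠ z) (η : V → ℕ) (p : Bool → ℕ) :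
    getPair x z (setPair x z η p) = p := by
  funext i
  cases i
  · simp [getPair, setPair_right]
  · simp [getPair, setPair_left hxz]

theorem setPair_congr {η η' : V → ℕ} (h : ∀ v, v ≠ x → v ≠ z → η v = η' v) (p : Bool → ℕ) :
    setPair x z η p = setPair x z η' p := by
  funext v
  unfold setPair
  by_cases hz : v = z
  · simp [hz]
  by_cases hx : v = x
  · simp [Function.update_apply, hx]
  · simp [hz, hx, h v hx hz]

/-- Resampling a pair of sites preserves the weights. -/
theorem sum_resample (hxz : x ≠ z) {a : V → ℝ} (ha : ∀ v, 0 < a v) (k : ℕ)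
    (H : (V → ℕ) → ℝ) :
    ∑ η ∈ confs V k, polyaWeight a η * ((∑ p ∈ confs Bool (η x + η z),
      polyaWeight (getPair x z a) p * H (setPair x z η p)) /
        boolMass (getPair x z a) (η x + η z)) = ∑ η ∈ confs V k, polyaWeight a η * H η := by
  have hb : ∀ i, 0 < getPair x z a i := fun i => by cases i <;> simp [getPair, ha]
  have h1 : ∀ η : V → ℕ, polyaWeight a η * H η = ∑ p ∈ confs Bool (η x + η z),
      polyaWeight a η * (polyaWeight (getPair x z a) p * H η /
        boolMass (getPair x z a) (η x + η z)) := fun η => by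
    have := boolMass_pos hb (η x + η z)
    rw [← Finset.mul_sum, ← Finset.sum_div, ← Finset.sum_mul, ← boolMass]
    field_simp
  rw [Finset.sum_congr rfl fun η _ => h1 η]
  simp_rw [Finset.sum_div, Finset.mul_sum]
  rw [Finset.sum_sigma', Finset.sum_sigma']
  -- Trading the occupation numbers at `x`, `z` with the sample `p` is an involution of the pairs
  -- `(η, p)`; it preserves the product weight by `polyaWeight_setPair`.
  have hi : ∀ s ∈ (confs V k).sigma fun η => confs Bool (η x + η z),
      (⟨setPair x z s.1 s.2, getPair x z s.1⟩ : Σ _ : V → ℕ, (Bool → ℕ)) ∈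
        (confs V k).sigma fun η => confs Bool (η x + η z) := by
    rintro ⟨η, p⟩ h
    rw [Finset.mem_sigma] at h ⊢
    refine ⟨setPair_mem hxz h.1 h.2, ?_⟩
    have := mem_confs.1 h.2
    simp only [Fintype.sum_bool] at this
    simp only [mem_confs, Fintype.sum_bool, setPair_left hxz, setPair_right, this]
    simp [getPair]
  have hinv : ∀ s : Σ _ : V → ℕ, (Bool → ℕ),
      (⟨setPair x z (setPair x z s.1 s.2) (getPair x z s.1),
        getPair x z (setPair x z s.1 s.2)⟩ : Σ _ : V → ℕ, (Bool → ℕ)) = s := by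
    rintro ⟨η, p⟩
    simp only [setPair_setPair hxz, getPair_setPair hxz]
  refine Finset.sum_bij' (fun s _ => ⟨setPair x z s.1 s.2, getPair x z s.1⟩)
    (fun s _ => ⟨setPair x z s.1 s.2, getPair x z s.1⟩) hi hi (fun s _ => hinv s)
    (fun s _ => hinv s) ?_
  rintro ⟨η, p⟩ h
  have h2 := mem_confs.1 (Finset.mem_sigma.1 h).2
  simp only [Fintype.sum_bool] at h2
  simp only [setPair_left hxz, setPair_right, h2]
  have := polyaWeight_setPair hxz a η p
  linear_combination (-H (setPair x z η p) / boolMass (getPair x z a) (η x + η z)) * this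

/-- The Poincaré inequality for a pair of sites, conditionally on all the others. -/
theorem exists_pair_invariant_poincare (hxz : x ≠ z) {a : V → ℝ} (ha : ∀ v, 0 < a v) (k : ℕ)
    (f : (V → ℕ) → ℝ) :
    ∃ c : (V → ℕ) → ℝ, (∀ η η' : V → ℕ, η x + η z = η' x + η' z →
      (∀ v, v ≠ x → v ≠ z → η v = η' v) → c η = c η') ∧
      (a x + a z) * normSq a (k + 1) (fun η => f η - c η) ≤ pairForm a k x z f := by
  have hb : ∀ i, 0 < getPair x z a i := fun i => by cases i <;> simp [getPair, ha]
  set b := getPair x z a with hbdef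
  -- The conditional mean of `f` given `η x + η z` and all the other sites.
  let c : (V → ℕ) → ℝ := fun η => (∑ p ∈ confs Bool (η x + η z),
      polyaWeight b p * f (setPair x z η p)) / boolMass b (η x + η z)
  have hcinv : ∀ η η' : V → ℕ, η x + η z = η' x + η' z →
      (∀ v, v ≠ x → v ≠ z → η v = η' v) → c η = c η' := fun η η' h1 h2 => by
    simp only [c, h1, setPair_congr h2]
  refine ⟨c, hcinv, ?_⟩
  rw [pairForm_eq_sum _ _ hxz, normSq, ← sum_resample hxz ha,
    ← sum_resample hxz ha (k + 1) fun η => _ * (_ * _), Finset.mul_sum]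
  refine Finset.sum_le_sum fun η _ => ?_
  rw [mul_left_comm]
  refine mul_le_mul_of_nonneg_left ?_ (polyaWeight_nonneg (fun v => (ha v).le) η)
  have hM := boolMass_pos hb (η x + η z)
  rw [← mul_div_assoc]
  refine div_le_div_of_nonneg_right ?_ hM.le
  have key := bool_poincare_sub_mean hb (η x + η z) (fun p => f (setPair x z η p)) (c η)
    (by simp only [c]; field_simp)
  have hax : b true = a x := by simp [hbdef, getPair]
  have haz : b false = a z := by simp [hbdef, getPair]
  rw [hax, haz] at key
  refine (le_of_eq ?_).trans (key.trans (le_of_eq ?_))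
  · refine congrArg₂ _ rfl (Finset.sum_congr rfl fun p hp => ?_)
    rw [hcinv (setPair x z η p) η _ fun v hx hz => setPair_of_ne hx hz _ _]
    rw [setPair_left hxz, setPair_right]
    simpa using mem_confs.1 hp
  · refine Finset.sum_congr rfl fun p _ => ?_
    rw [setPair_left hxz, setPair_right]
    congr 6
    funext v
    by_cases hz : v = z
    · subst hz; simp [setPair, hxz.symm]
    by_cases hx : v = x
    · subst hx; simp [setPair, hxz]
    · simp [setPair, hx, hz]

end Resampling

/-! ### Splitting sites into cores, and swapping cores. -/

noncomputable section Lifting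

set_option linter.unusedSectionVars false

section Permutation

variable {W : Type*} [Fintype W] [DecidableEq W]

theorem comp_perm_mem {k : ℕ} {ω : W → ℕ} (σ : Equiv.Perm W) (h : ω ∈ confs W k) :
    ω ∘ σ ∈ confs W k := by
  rw [mem_confs] at *
  rw [← h]
  exact Equiv.sum_comp σ ω

theorem sum_confs_comp_perm (σ : Equiv.Perm W) (k : ℕ) (H : (W → ℕ) → ℝ) :
    ∑ ω ∈ confs W k, H (ω ∘ σ) = ∑ ω ∈ confs W k, H ω :=
  Finset.sum_bij' (fun ω _ => ω ∘ σ) (fun ω _ => ω ∘ σ.symm) (fun _ h => comp_perm_mem σ h)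
    (fun _ h => comp_perm_mem σ.symm h) (fun ω _ => by funext; simp) (fun ω _ => by funext; simp)
    (fun _ _ => rfl)

theorem polyaWeight_comp_perm {b : W → ℝ} {σ : Equiv.Perm W} (hσ : ∀ u, b (σ u) = b u)
    (ω : W → ℕ) : polyaWeight b (ω ∘ σ) = polyaWeight b ω := by
  unfold polyaWeight
  rw [← Equiv.prod_comp σ fun u => polyaFactor (b u) (ω u)]
  exact Finset.prod_congr rfl fun u _ => by rw [hσ]; rfl

theorem normSq_comp_perm {b : W → ℝ} {σ : Equiv.Perm W} (hσ : ∀ u, b (σ u) = b u) (k : ℕ)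
    (g : (W → ℕ) → ℝ) : normSq b k (fun ω => g (ω ∘ σ)) = normSq b k g := by
  unfold normSq
  rw [← sum_confs_comp_perm σ k fun ω => polyaWeight b ω * g ω ^ 2]
  simp_rw [polyaWeight_comp_perm hσ]

theorem add_unitAt_comp_perm (σ : Equiv.Perm W) (ξ : W → ℕ) (u : W) :
    (ξ + unitAt (σ u)) ∘ σ = ξ ∘ σ + unitAt u := by
  funext v
  simp [Pi.single_apply]

theorem pairForm_comp_perm {b : W → ℝ} {σ : Equiv.Perm W} (hσ : ∀ u, b (σ u) = b u) (k : ℕ)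
    (u v : W) (g : (W → ℕ) → ℝ) :
    pairForm b k (σ u) (σ v) (fun ω => g (ω ∘ σ)) = pairForm b k u v g := by
  unfold pairForm
  refine Eq.trans (Finset.sum_congr rfl fun ω _ => ?_) (sum_confs_comp_perm σ k _)
  beta_reduce
  rw [polyaWeight_comp_perm hσ, add_unitAt_comp_perm, add_unitAt_comp_perm, hσ, hσ]
  rfl

/-- This is `n(G + H)² ≤ (n + 1)(G² + nH²)`, whose defect is `(G - nH)²`. The weights are tuned so
that telescoping over a path of length `n + 1` costs a factor `n + 1`. -/
theorem pairForm_add_le {b : W → ℝ} (hb : ∀ u, 0 ≤ b u) (k n : ℕ) (u v : W)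
    (g h : (W → ℕ) → ℝ) :
    n * pairForm b k u v (fun ω => g ω + h ω) ≤
      (n + 1) * (pairForm b k u v g + n * pairForm b k u v h) := by
  unfold pairForm
  rw [Finset.mul_sum, Finset.mul_sum, ← Finset.sum_add_distrib, Finset.mul_sum]
  refine Finset.sum_le_sum fun ω _ => ?_
  have h1 := hb u
  have h2 := hb v
  have h3 := polyaWeight_nonneg hb ω
  have h4 : 0 ≤ polyaWeight b ω * (b u + ω u) * (b v + ω v) := by positivity
  have h5 := mul_nonneg h4 (sq_nonneg ((g (ω + unitAt u) - g (ω + unitAt v)) -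
    n * (h (ω + unitAt u) - h (ω + unitAt v))))
  linarith

theorem normSq_sub_le {b : W → ℝ} (hb : ∀ u, 0 ≤ b u) (k : ℕ) (g h : (W → ℕ) → ℝ) :
    normSq b k (fun ω => g ω - h ω) ≤ 2 * normSq b k g + 2 * normSq b k h := by
  unfold normSq
  rw [Finset.mul_sum, Finset.mul_sum, ← Finset.sum_add_distrib]
  refine Finset.sum_le_sum fun ω _ => ?_
  have h5 := mul_nonneg (polyaWeight_nonneg hb ω) (sq_nonneg (g ω + h ω))
  linarith

end Permutation

variable {V : Type*} [Fintype V] [DecidableEq V]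

/-- Every site is split into a core of weight `β` and the rest. -/
def splitWeight (β : ℝ) (a : V → ℝ) : V × Bool → ℝ := fun u => if u.2 then β else a u.1 - β

/-- The configuration on `V` obtained by merging the core of each site with the rest. -/
def merge (ω : V × Bool → ℕ) : V → ℕ := fun v => ω (v, true) + ω (v, false)

theorem merge_add_unitAt (ω : V × Bool → ℕ) (v : V) (i : Bool) :
    merge (ω + unitAt (v, i)) = merge ω + unitAt v := by
  funext z
  by_cases hz : z = v
  · subst hz; cases i <;> simp [merge] <;> omega
  · simp [merge, hz]

theorem splitWeight_nonneg {β : ℝ} {a : V → ℝ} (hβ : 0 ≤ β) (ha : ∀ v, β ≤ a v) (u : V × Bool) :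
    0 ≤ splitWeight β a u := by
  unfold splitWeight
  split_ifs
  · exact hβ
  · exact sub_nonneg.2 (ha _)

theorem sum_splitWeight (β : ℝ) (a : V → ℝ) : ∑ u, splitWeight β a u = ∑ v, a v := by
  simp [Fintype.sum_prod_type, splitWeight]

/-- Merging maps the weights of the split sites to the weights of the sites. -/
theorem sum_merge (β : ℝ) (a : V → ℝ) (k : ℕ) (h : (V → ℕ) → ℝ) :
    ∑ ω ∈ confs (V × Bool) k, polyaWeight (splitWeight β a) ω * h (merge ω) =
      ∑ η ∈ confs V k, polyaWeight a η * h η := by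
  induction k generalizing h with
  | zero =>
    have : merge (0 : V × Bool → ℕ) = 0 := by funext; simp [merge]
    simp [confs, this, polyaWeight, polyaFactor]
  | succ k ih =>
    have hk : (k : ℝ) + 1 ≠ 0 := by positivity
    refine mul_left_cancel₀ hk ?_
    -- The new particle enters site `v` at rate `a v + η v`, which is the sum of the rates of its
    -- core and its rest.
    rw [sum_confs_total a k h, sum_confs_total _ k fun ω => h (merge ω), Fintype.sum_prod_type]
    refine Finset.sum_congr rfl fun v _ => ?_
    have := ih fun η => (a v + η v) * h (η + unitAt v)
    simp_rw [← mul_assoc] at this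
    rw [← this, Fintype.sum_bool, ← Finset.sum_add_distrib]
    refine Finset.sum_congr rfl fun ξ _ => ?_
    rw [merge_add_unitAt, merge_add_unitAt]
    simp [splitWeight, merge]
    ring

/-- Given the merged configuration, the mean occupation of a core is proportional to its weight. -/
theorem sum_merge_core (β : ℝ) {a : V → ℝ} (x : V) (k : ℕ) (h : (V → ℕ) → ℝ) :
    a x * ∑ ω ∈ confs (V × Bool) k,
        polyaWeight (splitWeight β a) ω * (ω (x, true) * h (merge ω)) =
      β * ∑ η ∈ confs V k, polyaWeight a η * (η x * h η) := by
  induction k generalizing h with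
  | zero => simp [confs]
  | succ k ih =>
    have h1 := ih fun η => h (η + unitAt x)
    have h2 := sum_merge β a k fun η => h (η + unitAt x)
    simp_rw [← mul_assoc (polyaWeight _ _)]
    rw [sum_confs_mul_coord, sum_confs_mul_coord]
    simp_rw [merge_add_unitAt, mul_add, add_mul, Finset.sum_add_distrib, mul_add]
    simp_rw [← mul_assoc (polyaWeight _ _)] at h1
    rw [h1]
    congr 1
    have h3 : ∀ s : Finset (V × Bool → ℕ), ∑ ω ∈ s, polyaWeight (splitWeight β a) ω *
        splitWeight β a (x, true) * h (merge ω + unitAt x) = β * ∑ ω ∈ s,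
          polyaWeight (splitWeight β a) ω * h (merge ω + unitAt x) := fun s => by
      rw [Finset.mul_sum]
      exact Finset.sum_congr rfl fun ω _ => by simp [splitWeight]; ring
    rw [h3, h2, Finset.mul_sum, Finset.mul_sum, Finset.mul_sum]
    exact Finset.sum_congr rfl fun ω _ => by ring

/-- The Dirichlet form of the exchanges between the core of `x` and the site `y`. -/
def coreForm (β : ℝ) (a : V → ℝ) (k : ℕ) (x y : V) (g : (V × Bool → ℕ) → ℝ) : ℝ :=
  ∑ i, pairForm (splitWeight β a) k (x, true) (y, i) g

/-- The rate out of the core is `β + ω (x, true)`, whose conditional mean given the merged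
configuration is the fraction `β / a x` of `a x + η x`. -/
theorem coreForm_merge (β : ℝ) (a : V → ℝ) (k : ℕ) (x y : V) (f : (V → ℕ) → ℝ) :
    a x * coreForm β a k x y (fun ω => f (merge ω)) = β * pairForm a k x y f := by
  let h : (V → ℕ) → ℝ := fun η => (a y + η y) * (f (η + unitAt x) - f (η + unitAt y)) ^ 2
  have h1 : coreForm β a k x y (fun ω => f (merge ω)) =
      ∑ ω ∈ confs (V × Bool) k, (β * (polyaWeight (splitWeight β a) ω * h (merge ω)) +
        polyaWeight (splitWeight β a) ω * (ω (x, true) * h (merge ω))) := by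
    unfold coreForm pairForm
    rw [Fintype.sum_bool, ← Finset.sum_add_distrib]
    refine Finset.sum_congr rfl fun ω _ => ?_
    simp only [merge_add_unitAt, h]
    simp [splitWeight, merge]
    ring
  rw [h1, Finset.sum_add_distrib, ← Finset.mul_sum, mul_add, sum_merge_core, sum_merge, pairForm,
    Finset.mul_sum, Finset.mul_sum, Finset.mul_sum, Finset.mul_sum, ← Finset.sum_add_distrib]
  exact Finset.sum_congr rfl fun η _ => by simp only [h]; ring

/-- The two exchanges involved are part of the complete graph on the split sites, where
`sum_pairForm_add` bounds the whole form by the norm. Both orientations occur in the double sum,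
which absorbs the division by two. -/
theorem coreForm_le {β : ℝ} {a : V → ℝ} (hβ : 0 ≤ β) (ha : ∀ v, β ≤ a v) (k : ℕ) {x y : V}
    (hxy : x ≠ y) (g : (V × Bool → ℕ) → ℝ) :
    coreForm β a k x y g ≤
      ((k : ℝ) + 1) * (∑ v, a v + k) * normSq (splitWeight β a) (k + 1) g := by
  have hb := splitWeight_nonneg hβ ha
  have h1 := sum_pairForm_add (splitWeight β a) k g
  have h2 := normSq_nonneg hb k (annihilate (splitWeight β a) g)
  rw [sum_splitWeight] at h1
  rw [← h1]
  have h3 : 2 * coreForm β a k x y g ≤ ∑ u, ∑ v, pairForm (splitWeight β a) k u v g := by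
    rw [← Fintype.sum_prod_type' (f := fun u v => pairForm (splitWeight β a) k u v g)]
    have h4 := Finset.sum_le_univ_sum_of_nonneg
      (f := fun p : (V × Bool) × (V × Bool) => pairForm (splitWeight β a) k p.1 p.2 g)
      (s := {((x, true), (y, true)), ((x, true), (y, false)), ((y, true), (x, true)),
        ((y, false), (x, true))}) fun p => pairForm_nonneg hb k _ _ _
    rw [Finset.sum_insert (by simp [hxy]), Finset.sum_insert (by simp [hxy]),
      Finset.sum_insert (by simp), Finset.sum_singleton] at h4
    simp only at h4
    rw [pairForm_comm _ _ (y, true), pairForm_comm _ _ (y, false)] at h4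
    rw [coreForm, Fintype.sum_bool]
    linarith
  linarith

/-- Exchanging the cores of `x` and `z`. -/
def coreSwap (x z : V) : Equiv.Perm (V × Bool) := Equiv.swap (x, true) (z, true)

theorem splitWeight_coreSwap (β : ℝ) (a : V → ℝ) (x z : V) (u : V × Bool) :
    splitWeight β a (coreSwap x z u) = splitWeight β a u := by
  unfold coreSwap
  rw [Equiv.swap_apply_def]
  split_ifs with h1 h2
  · simp [splitWeight, h1]
  · simp [splitWeight, h2]
  · rfl

theorem coreForm_coreSwap (β : ℝ) (a : V → ℝ) (k : ℕ) {x y z : V} (hyx : y ≠ x) (hyz : y ≠ z)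
    (g : (V × Bool → ℕ) → ℝ) :
    coreForm β a k z y (fun ω => g (ω ∘ coreSwap x z)) = coreForm β a k x y g := by
  unfold coreForm
  refine Finset.sum_congr rfl fun i _ => ?_
  rw [← pairForm_comp_perm (splitWeight_coreSwap β a x z) k (x, true) (y, i) g]
  congr 1
  · simp [coreSwap]
  · rw [coreSwap, Equiv.swap_apply_of_ne_of_ne] <;> simp [hyx, hyz]

theorem merge_coreSwap (x z : V) (ω : V × Bool → ℕ) :
    merge (ω ∘ coreSwap x z) x + merge (ω ∘ coreSwap x z) z = merge ω x + merge ω z ∧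
      ∀ v, v ≠ x → v ≠ z → merge (ω ∘ coreSwap x z) v = merge ω v := by
  have h : ∀ v, coreSwap x z (v, false) = (v, false) := fun v => by
    rw [coreSwap, Equiv.swap_apply_of_ne_of_ne] <;> simp
  refine ⟨?_, fun v hx hz => ?_⟩
  · simp only [merge, Function.comp, h]
    simp [coreSwap]
    omega
  · simp only [merge, Function.comp, h]
    rw [coreSwap, Equiv.swap_apply_of_ne_of_ne] <;> simp [hx, hz]

/-- The conditional mean `c` of `f` on the pair is unchanged by the swap, so `f` may be replaced by
`f - c`. The swap preserves the norm, giving a factor 4; the pair inequality has constant `a x + a z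
≥ 2 * β`, leaving 2. -/
theorem normSq_coreSwap_sub_le {β : ℝ} {a : V → ℝ} (hβ : 0 < β) (ha : ∀ v, β ≤ a v) (k : ℕ)
    {x z : V} (hxz : x ≠ z) (f : (V → ℕ) → ℝ) :
    β * normSq (splitWeight β a) (k + 1)
      (fun ω => f (merge (ω ∘ coreSwap x z)) - f (merge ω)) ≤ 2 * pairForm a k x z f := by
  have hb := splitWeight_nonneg hβ.le ha
  obtain ⟨c, hc, hp⟩ := exists_pair_invariant_poincare hxz (fun v => hβ.trans_le (ha v)) k f
  obtain ⟨g, hg⟩ : ∃ g : (V × Bool → ℕ) → ℝ, ∀ ω, g ω = f (merge ω) - c (merge ω) :=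
    ⟨_, fun _ => rfl⟩
  have h1 : (fun ω : V × Bool → ℕ => f (merge (ω ∘ coreSwap x z)) - f (merge ω)) =
      fun ω => g (ω ∘ coreSwap x z) - g ω := by
    funext ω
    have := merge_coreSwap x z ω
    rw [hg, hg, hc _ _ this.1 this.2]
    ring
  have h2 := normSq_sub_le hb (k + 1) (fun ω => g (ω ∘ coreSwap x z)) g
  rw [normSq_comp_perm (splitWeight_coreSwap β a x z)] at h2
  have h3 : normSq (splitWeight β a) (k + 1) g = normSq a (k + 1) fun η => f η - c η := by
    rw [funext hg]
    exact sum_merge β a (k + 1) fun η => (f η - c η) ^ 2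
  rw [h1]
  rw [h3] at h2
  have h4 := normSq_nonneg (fun v => hβ.le.trans (ha v)) (k + 1) fun η => f η - c η
  have := ha x
  have := ha z
  nlinarith

/-- Moving the core of `x` to a neighbour `z` before exchanging with `y`. -/
theorem coreForm_step {β : ℝ} {a : V → ℝ} (hβ : 0 < β) (ha : ∀ v, β ≤ a v) (k n : ℕ)
    {x y z : V} (hxz : x ≠ z) (hyx : y ≠ x) (hyz : y ≠ z) (f : (V → ℕ) → ℝ) :
    n * coreForm β a k x y (fun ω => f (merge ω)) ≤
      (n + 1) * (coreForm β a k z y (fun ω => f (merge ω)) +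
        n * (2 * (((k : ℝ) + 1) * (∑ v, a v + k)) / β * pairForm a k x z f)) := by
  have hb := splitWeight_nonneg hβ.le ha
  set M := ((k : ℝ) + 1) * (∑ v, a v + k)
  have hM : 0 ≤ M := by
    have : 0 ≤ ∑ v, a v := Finset.sum_nonneg fun v _ => hβ.le.trans (ha v)
    positivity
  let g : (V × Bool → ℕ) → ℝ := fun ω => f (merge (ω ∘ coreSwap x z)) - f (merge ω)
  -- The swap turns the core of `x` into that of `z`; the function becomes the original one plus the
  -- error `g`.
  have h1 : n * coreForm β a k x y (fun ω => f (merge ω)) ≤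
      (n + 1) * (coreForm β a k z y (fun ω => f (merge ω)) + n * coreForm β a k z y g) := by
    rw [← coreForm_coreSwap β a k hyx hyz]
    unfold coreForm
    rw [Finset.mul_sum, Finset.mul_sum, ← Finset.sum_add_distrib, Finset.mul_sum]
    refine Finset.sum_le_sum fun i _ => ?_
    refine le_trans (le_of_eq ?_) (pairForm_add_le hb k n _ _ _ _)
    congr 2
    funext ω
    simp [g]
  have h2 := coreForm_le hβ.le ha k hyz.symm g
  have h3 := normSq_coreSwap_sub_le hβ ha k hxz f
  have h4 : coreForm β a k z y g ≤ 2 * M / β * pairForm a k x z f := by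
    refine h2.trans ?_
    rw [div_mul_eq_mul_div, le_div_iff₀ hβ]
    have := mul_le_mul_of_nonneg_left h3 hM
    linarith
  refine h1.trans ?_
  gcongr

end Lifting

/-! ### Comparison of long-range exchanges with the edges of the graph. -/

noncomputable section Geodesics

set_option linter.unusedSectionVars false

variable {V : Type*} [Fintype V] [DecidableEq V]

/-- The Dirichlet form of the inclusion process with `k + 1` particles. -/
def sipEnergy (G : WeightedGraph V) (a : V → ℝ) (k : ℕ) (f : (V → ℕ) → ℝ) : ℝ :=
  (∑ x, ∑ y, G.c x y * pairForm a k x y f) / 2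

theorem sipEnergy_nonneg (G : WeightedGraph V) {a : V → ℝ} (ha : ∀ x, 0 ≤ a x) (k : ℕ)
    (f : (V → ℕ) → ℝ) : 0 ≤ sipEnergy G a k f :=
  div_nonneg (Finset.sum_nonneg fun x _ => Finset.sum_nonneg fun y _ =>
    mul_nonneg (G.nonneg x y) (pairForm_nonneg ha k x y f)) zero_le_two

theorem WeightedGraph.cMin_le (G : WeightedGraph V) {x y : V} (h : 0 < G.c x y) :
    G.cMin ≤ G.c x y :=
  ciInf_le (f := fun e : {e : V × V // 0 < G.c e.1 e.2} => G.c e.1.1 e.1.2)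
    (Set.finite_range _).bddBelow ⟨(x, y), h⟩

theorem WeightedGraph.exists_conductance_pos [Nontrivial V] (G : WeightedGraph V)
    (hG : G.toSimpleGraph.Connected) : ∃ x y, 0 < G.c x y := by
  obtain ⟨x⟩ := hG.nonempty
  obtain ⟨y, hy⟩ := hG.preconnected.exists_adj_of_nontrivial x
  exact ⟨x, y, hy⟩

theorem WeightedGraph.cMin_pos [Nontrivial V] (G : WeightedGraph V)
    (hG : G.toSimpleGraph.Connected) : 0 < G.cMin := by
  obtain ⟨x, y, h⟩ := G.exists_conductance_pos hG
  have : Nonempty {e : V × V // 0 < G.c e.1 e.2} := ⟨⟨(x, y), h⟩⟩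
  obtain ⟨e, he⟩ := exists_eq_ciInf_of_finite
    (f := fun e : {e : V × V // 0 < G.c e.1 e.2} => G.c e.1.1 e.1.2)
  rw [WeightedGraph.cMin, ← he]
  exact e.2

open Classical in
/-- The oriented edges from the ball of radius `d` about `y` that lead closer to `y`. -/
def descendingEdges (G : SimpleGraph V) (y : V) (d : ℕ) : Finset (V × V) :=
  {e | G.Adj e.1 e.2 ∧ G.dist e.2 y < G.dist e.1 y ∧ G.dist e.1 y ≤ d}

theorem SimpleGraph.Connected.exists_adj_dist_eq {G : SimpleGraph V} (hG : G.Connected) {x y : V}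
    {d : ℕ} (h : G.dist x y = d + 1) : ∃ z, G.Adj x z ∧ G.dist z y = d := by
  obtain ⟨p, hp⟩ := hG.exists_walk_length_eq_dist x y
  cases p with
  | nil => simp at h
  | @cons _ z _ hxz q =>
    refine ⟨z, hxz, ?_⟩
    rw [SimpleGraph.Walk.length_cons] at hp
    have h1 := SimpleGraph.dist_le q
    have h2 := hG.dist_triangle (u := x) (v := z) (w := y)
    rw [SimpleGraph.dist_eq_one_iff_adj.2 hxz] at h2
    omega

/-- Distance to `y` strictly decreases along the chosen orientation, so each edge is counted at most
once, matching the factor one half in the energy. -/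
theorem cMin_mul_sum_descendingEdges_le (G : WeightedGraph V) {a : V → ℝ} (ha : ∀ x, 0 ≤ a x)
    (k d : ℕ) (y : V) (f : (V → ℕ) → ℝ) :
    G.cMin * ∑ e ∈ descendingEdges G.toSimpleGraph y d, pairForm a k e.1 e.2 f ≤
      sipEnergy G a k f := by
  classical
  set E := descendingEdges G.toSimpleGraph y d
  let t : V × V → ℝ := fun e => if e ∈ E then pairForm a k e.1 e.2 f else 0
  have h1 : ∑ e ∈ E, pairForm a k e.1 e.2 f = ∑ e, t e := by
    simp [t]
  have h2 : ∑ e, t e = ∑ e : V × V, t e.swap := (Equiv.sum_comp (Equiv.prodComm V V) t).symm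
  have h3 : 2 * (G.cMin * ∑ e, t e) ≤ ∑ e : V × V, G.c e.1 e.2 * pairForm a k e.1 e.2 f := by
    have : 2 * (G.cMin * ∑ e, t e) = ∑ e, G.cMin * (t e + t e.swap) := by
      rw [← Finset.mul_sum, Finset.sum_add_distrib, ← h2]; ring
    rw [this]
    refine Finset.sum_le_sum fun e _ => ?_
    have hP := pairForm_nonneg ha k e.1 e.2 f
    by_cases he : e ∈ E
    · have h4 : e.swap ∉ E := by
        simp only [E, descendingEdges, Finset.mem_filter, Prod.fst_swap, Prod.snd_swap] at he ⊢
        omega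
      have h5 : 0 < G.c e.1 e.2 := by
        simp only [E, descendingEdges, Finset.mem_filter] at he
        exact he.2.1
      simp only [t, he, h4, if_true, if_false, add_zero]
      exact mul_le_mul_of_nonneg_right (G.cMin_le h5) hP
    · by_cases h4 : e.swap ∈ E
      · have h5 : 0 < G.c e.1 e.2 := by
          simp only [E, descendingEdges, Finset.mem_filter] at h4
          rw [G.symm]
          exact h4.2.1
        simp only [t, he, h4, if_true, if_false, zero_add, Prod.fst_swap, Prod.snd_swap]
        rw [pairForm_comm]
        exact mul_le_mul_of_nonneg_right (G.cMin_le h5) hP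
      · simp only [t, he, h4, if_false, add_zero, mul_zero]
        exact mul_nonneg (G.nonneg _ _) hP
  rw [h1, sipEnergy, ← Fintype.sum_prod_type' (f := fun x y => G.c x y * pairForm a k x y f)]
  linarith

theorem coreForm_le_of_dist (G : SimpleGraph V) (hG : G.Connected) {β : ℝ} {a : V → ℝ}
    (hβ : 0 < β) (ha : ∀ v, β ≤ a v) (k : ℕ) (f : (V → ℕ) → ℝ) (y : V) (d : ℕ) (x : V)
    (hd : G.dist x y = d + 1) :
    coreForm β a k x y (fun ω => f (merge ω)) ≤
      ((d + 1 : ℕ) : ℝ) * (2 * (((k : ℝ) + 1) * (∑ v, a v + k)) / β *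
        ∑ e ∈ descendingEdges G y (d + 1), pairForm a k e.1 e.2 f) := by
  have ha0 : ∀ v, 0 ≤ a v := fun v => hβ.le.trans (ha v)
  -- The last edge of the path needs no swap and costs a bare `pairForm`; this lets it be charged at
  -- the same rate as the others.
  have hK : 1 ≤ 2 * (((k : ℝ) + 1) * (∑ v, a v + k)) / β := by
    rw [le_div_iff₀ hβ]
    have h1 : β ≤ ∑ v, a v :=
      (ha x).trans (Finset.single_le_sum (fun v _ => ha0 v) (Finset.mem_univ x))
    have hk : (0 : ℝ) ≤ k := k.cast_nonneg
    nlinarith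
  generalize hKdef : 2 * (((k : ℝ) + 1) * (∑ v, a v + k)) / β = K at hK
  induction d generalizing x with
  | zero =>
    have hadj : G.Adj x y := SimpleGraph.dist_eq_one_iff_adj.1 (by simpa using hd)
    have h1 := coreForm_merge β a k x y f
    have h2 : pairForm a k x y f ≤
        ∑ e ∈ descendingEdges G y (0 + 1), pairForm a k e.1 e.2 f := by
      refine Finset.single_le_sum (f := fun e : V × V => pairForm a k e.1 e.2 f)
        (a := (x, y)) (fun e _ => pairForm_nonneg ha0 k _ _ f) ?_
      simp [descendingEdges, hadj, hd]
    have h3 := pairForm_nonneg ha0 k x y f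
    have h4 : coreForm β a k x y (fun ω => f (merge ω)) ≤ pairForm a k x y f := by
      refine le_of_mul_le_mul_left ?_ (hβ.trans_le (ha x))
      rw [h1]
      exact mul_le_mul_of_nonneg_right (ha x) h3
    have h5 := h3.trans h2
    have := mul_le_mul_of_nonneg_right hK h5
    simp only [zero_add, Nat.cast_one, one_mul] at *
    linarith
  | succ d ih =>
    obtain ⟨z, hxz, hz⟩ := hG.exists_adj_dist_eq hd
    have hyx : y ≠ x := by rintro rfl; simp at hd
    have hyz : y ≠ z := by rintro rfl; simp at hz
    have h1 := coreForm_step hβ ha k (d + 1) hxz.ne hyx hyz f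
    rw [hKdef] at h1
    have h2 := ih z hz
    -- The edge from `x` to `z` starts at distance `d + 2` from `y`, so it is new to the larger
    -- ball.
    have h3 : pairForm a k x z f + ∑ e ∈ descendingEdges G y (d + 1), pairForm a k e.1 e.2 f ≤
        ∑ e ∈ descendingEdges G y (d + 1 + 1), pairForm a k e.1 e.2 f := by
      rw [← Finset.sum_insert (f := fun e : V × V => pairForm a k e.1 e.2 f) (a := (x, z))
        (by simp [descendingEdges, hd])]
      refine Finset.sum_le_sum_of_subset_of_nonneg ?_ fun e _ _ => pairForm_nonneg ha0 k _ _ f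
      intro e he
      rw [Finset.mem_insert] at he
      rcases he with rfl | he
      · simp [descendingEdges, hd, hz, hxz]
      · simp only [descendingEdges, Finset.mem_filter] at he ⊢
        exact ⟨he.1, he.2.1, he.2.2.1, he.2.2.2.trans (Nat.le_succ _)⟩
    have hn : (0 : ℝ) < ((d + 1 : ℕ) : ℝ) := by positivity
    refine le_of_mul_le_mul_left (h1.trans ?_) hn
    push_cast at *
    set S := ∑ e ∈ descendingEdges G y (d + 1), pairForm a k e.1 e.2 f
    set S' := ∑ e ∈ descendingEdges G y (d + 1 + 1), pairForm a k e.1 e.2 f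
    calc ((d : ℝ) + 1 + 1) * (coreForm β a k z y (fun ω => f (merge ω)) +
          (d + 1) * (K * pairForm a k x z f))
        ≤ ((d : ℝ) + 1 + 1) * ((d + 1) * (K * S) + (d + 1) * (K * pairForm a k x z f)) := by
          gcongr
      _ = ((d : ℝ) + 1) * ((d + 1 + 1) * (K * (pairForm a k x z f + S))) := by ring
      _ ≤ _ := by gcongr

theorem pairForm_le_energy [Nontrivial V] (G : WeightedGraph V) (hG : G.toSimpleGraph.Connected)
    {β A : ℝ} {a : V → ℝ} (hβ : 0 < β) (ha : ∀ v, β ≤ a v) (hA : ∀ v, a v ≤ A) (k : ℕ)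
    (f : (V → ℕ) → ℝ) (x y : V) :
    β ^ 2 * G.cMin * pairForm a k x y f ≤
      2 * A * (((k : ℝ) + 1) * (∑ v, a v + k)) * G.toSimpleGraph.diam * sipEnergy G a k f := by
  have ha0 : ∀ v, 0 ≤ a v := fun v => hβ.le.trans (ha v)
  have hE := sipEnergy_nonneg G ha0 k f
  have hA0 : 0 ≤ A := (ha0 x).trans (hA x)
  have hc := G.cMin_pos hG
  have hM : 0 ≤ ((k : ℝ) + 1) * (∑ v, a v + k) := by
    have : 0 ≤ ∑ v, a v := Finset.sum_nonneg fun v _ => ha0 v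
    positivity
  set M := ((k : ℝ) + 1) * (∑ v, a v + k)
  by_cases hxy : x = y
  · subst hxy
    rw [pairForm_self]
    simp only [mul_zero]
    positivity
  obtain ⟨d, hd⟩ := Nat.exists_eq_succ_of_ne_zero (hG.pos_dist_of_ne hxy).ne'
  have h1 := coreForm_le_of_dist G.toSimpleGraph hG hβ ha k f y d x hd
  have h2 := cMin_mul_sum_descendingEdges_le G ha0 k (d + 1) y f
  have h3 := coreForm_merge β a k x y f
  have hdiam : ((d + 1 : ℕ) : ℝ) ≤ G.toSimpleGraph.diam := by
    have : G.toSimpleGraph.dist x y ≤ G.toSimpleGraph.diam :=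
      SimpleGraph.dist_le_diam (SimpleGraph.connected_iff_ediam_ne_top.1 hG)
    rw [hd] at this
    exact_mod_cast this
  set S := ∑ e ∈ descendingEdges G.toSimpleGraph y (d + 1), pairForm a k e.1 e.2 f
  calc β ^ 2 * G.cMin * pairForm a k x y f
      = β * G.cMin * (a x * coreForm β a k x y (fun ω => f (merge ω))) := by rw [h3]; ring
    _ ≤ β * G.cMin * (a x * (((d + 1 : ℕ) : ℝ) * (2 * M / β * S))) := by
        have := ha0 x
        gcongr
    _ = 2 * a x * M * ((d + 1 : ℕ) : ℝ) * (G.cMin * S) := by field_simp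
    _ ≤ 2 * A * M * G.toSimpleGraph.diam * sipEnergy G a k f := by
        have := ha0 x
        have := hA x
        have : 0 ≤ G.cMin * S :=
          mul_nonneg hc.le (Finset.sum_nonneg fun e _ => pairForm_nonneg ha0 k _ _ f)
        gcongr

/-- The Poincaré inequality on the kernel of the annihilation operator. -/
theorem normSq_le_energy [Nontrivial V] (G : WeightedGraph V) (hG : G.toSimpleGraph.Connected)
    {β A : ℝ} {a : V → ℝ} (hβ : 0 < β) (ha : ∀ v, β ≤ a v) (hA : ∀ v, a v ≤ A) (k : ℕ)
    {f : (V → ℕ) → ℝ} (hf : ∀ ξ ∈ confs V k, annihilate a f ξ = 0) :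
    β ^ 2 * G.cMin * normSq a (k + 1) f ≤
      A * ((Fintype.card V : ℝ) ^ 2 * G.toSimpleGraph.diam) * sipEnergy G a k f := by
  have h1 := sum_pairForm_add a k f
  have h2 : normSq a k (annihilate a f) = 0 :=
    Finset.sum_eq_zero fun ξ hξ => by rw [hf ξ hξ]; ring
  rw [h2, add_zero] at h1
  have hM : 0 < ((k : ℝ) + 1) * (∑ v, a v + k) := by
    have : 0 < ∑ v, a v :=
      Finset.sum_pos (fun v _ => hβ.trans_le (ha v)) Finset.univ_nonempty
    positivity
  set M := ((k : ℝ) + 1) * (∑ v, a v + k)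
  -- The `M` from the spectral identity cancels the `M` lost in `pairForm_le_energy`, so the
  -- constant does not depend on the number of particles.
  refine le_of_mul_le_mul_left ?_ hM
  have h3 : ∑ x, ∑ y, β ^ 2 * G.cMin * pairForm a k x y f ≤
      ∑ _x : V, ∑ _y : V, 2 * A * M * G.toSimpleGraph.diam * sipEnergy G a k f :=
    Finset.sum_le_sum fun x _ => Finset.sum_le_sum fun y _ =>
      pairForm_le_energy G hG hβ ha hA k f x y
  simp_rw [← Finset.mul_sum] at h3
  simp only [Finset.sum_const, Finset.card_univ, nsmul_eq_mul] at h3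
  calc M * (β ^ 2 * G.cMin * normSq a (k + 1) f)
      = (β ^ 2 * G.cMin * ∑ x, ∑ y, pairForm a k x y f) / 2 := by
        rw [mul_left_comm, ← h1]; ring
    _ ≤ _ := by linarith

end Geodesics

/-! ### Eigenfunctions of the generator. -/

noncomputable section Generator

set_option linter.unusedSectionVars false

variable {V : Type*} [Fintype V] [DecidableEq V]

theorem WeightedGraph.sum_sum_eq_zero (G : WeightedGraph V) {T : V → V → ℝ}
    (hT : ∀ x y, T x y = -T y x) : ∑ x, ∑ y, G.c x y * T x y = 0 := by
  have h1 : ∑ x, ∑ y, G.c x y * T x y = ∑ x, ∑ y, G.c x y * T y x := by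
    rw [Finset.sum_comm]
    exact Finset.sum_congr rfl fun x _ => Finset.sum_congr rfl fun y _ => by rw [G.symm]
  have h2 : ∑ x, ∑ y, G.c x y * T x y = -∑ x, ∑ y, G.c x y * T y x := by
    simp_rw [← Finset.sum_neg_distrib]
    exact Finset.sum_congr rfl fun x _ => Finset.sum_congr rfl fun y _ => by rw [hT]; ring
  linarith

/-- The generator of the inclusion process, on functions of all configurations. -/
def confGenerator (G : WeightedGraph V) (a : V → ℝ) (F : (V → ℕ) → ℝ) : (V → ℕ) → ℝ :=
  fun η => ∑ x, ∑ y, G.c x y * (η x * ((a y + η y) * (F (η - unitAt x + unitAt y) - F η)))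

theorem sum_mul_confGenerator (G : WeightedGraph V) (a : V → ℝ) (k : ℕ) (F : (V → ℕ) → ℝ) :
    ∑ η ∈ confs V (k + 1), polyaWeight a η * (F η * confGenerator G a F η) =
      -sipEnergy G a k F := by
  let A : V → V → ℝ := fun x y => ∑ ξ ∈ confs V k, polyaWeight a ξ * (a x + ξ x) *
    ((a y + ξ y) * (F (ξ + unitAt y) - F (ξ + unitAt x)) * F (ξ + unitAt x))
  have h1 : ∑ η ∈ confs V (k + 1), polyaWeight a η * (F η * confGenerator G a F η) =
      ∑ x, ∑ y, G.c x y * A x y := by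
    unfold confGenerator
    simp_rw [Finset.mul_sum]
    rw [Finset.sum_comm]
    refine Finset.sum_congr rfl fun x _ => ?_
    rw [Finset.sum_comm]
    refine Finset.sum_congr rfl fun y _ => ?_
    by_cases hxy : x = y
    · subst hxy; simp [G.self]
    · have := sum_confs_mul_coord a k x
        (fun η => (a y + η y) * (F (η - unitAt x + unitAt y) - F η) * F η)
      simp only [sub_unitAt_of_add] at this
      simp only [Pi.add_apply, Pi.single_eq_of_ne (Ne.symm hxy), add_zero] at this
      simp only [A, ← this, Finset.mul_sum]
      exact Finset.sum_congr rfl fun η _ => by ring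
  have h2 : ∀ x y, A x y + A y x = -pairForm a k x y F := fun x y => by
    simp only [A, pairForm, ← Finset.sum_add_distrib, ← Finset.sum_neg_distrib]
    exact Finset.sum_congr rfl fun η _ => by ring
  -- Symmetric conductances see only the symmetric part of `A`, which is `-pairForm / 2`.
  have h3 := G.sum_sum_eq_zero (T := fun x y => A x y - A y x) fun x y => by ring
  have h4 : 2 * ∑ x, ∑ y, G.c x y * A x y = ∑ x, ∑ y, G.c x y * (A x y - A y x) -
      ∑ x, ∑ y, G.c x y * pairForm a k x y F := by
    simp_rw [Finset.mul_sum, ← Finset.sum_sub_distrib]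
    refine Finset.sum_congr rfl fun x _ => Finset.sum_congr rfl fun y _ => ?_
    linear_combination (G.c x y) * h2 x y
  rw [h1, sipEnergy]
  linarith

/-- The generator commutes with the annihilation operator. -/
theorem confGenerator_annihilate (G : WeightedGraph V) (a : V → ℝ) (F : (V → ℕ) → ℝ) :
    confGenerator G a (annihilate a F) = annihilate a (confGenerator G a F) := by
  funext ξ
  let L : V → V → ℝ := fun x y =>
    ξ x * ((a y + ξ y) * (annihilate a F (ξ - unitAt x + unitAt y) - annihilate a F ξ))
  let R : V → V → ℝ := fun x y => ∑ z, (a z + ξ z) * (((ξ + unitAt z) x : ℕ) *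
    ((a y + ((ξ + unitAt z) y : ℕ)) *
      (F (ξ + unitAt z - unitAt x + unitAt y) - F (ξ + unitAt z))))
  have hR : annihilate a (confGenerator G a F) ξ = ∑ x, ∑ y, G.c x y * R x y := by
    unfold annihilate confGenerator
    simp only [R, Finset.mul_sum]
    rw [Finset.sum_comm]
    refine Finset.sum_congr rfl fun x _ => ?_
    rw [Finset.sum_comm]
    exact Finset.sum_congr rfl fun y _ => Finset.sum_congr rfl fun z _ => by ring
  -- Edge by edge the operators fail to commute only by a term antisymmetric in `x` and `y`, which
  -- the symmetric conductances cancel in the sum.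
  have key : ∀ x y, x ≠ y → R x y = L x y +
      (a x + ξ x) * (a y + ξ y) * (F (ξ + unitAt y) - F (ξ + unitAt x)) := fun x y hxy => by
    let D : V → ℝ := fun z => F (ξ + unitAt z - unitAt x + unitAt y) - F (ξ + unitAt z)
    have hD : D x = F (ξ + unitAt y) - F (ξ + unitAt x) := by
      simp only [D, sub_unitAt_of_add]
    have h1 : R x y = ξ x * (a y + ξ y) * ∑ z, (a z + ξ z) * D z +
        (a x + ξ x) * (a y + ξ y) * D x + (a y + ξ y) * ξ x * D y := by
      have h2 : ∀ z, (a z + ξ z) * (((ξ + unitAt z) x : ℕ) *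
          ((a y + ((ξ + unitAt z) y : ℕ)) * D z)) = ξ x * (a y + ξ y) * ((a z + ξ z) * D z) +
          (if z = x then (a z + ξ z) * (a y + ξ y) * D z else 0) +
          (if z = y then (a z + ξ z) * ξ x * D z else 0) := fun z => by
        by_cases hzx : z = x
        · subst hzx; simp [hxy, hxy.symm]; ring
        by_cases hzy : z = y
        · subst hzy; simp [hzx, Ne.symm hzx]; ring
        · simp [hzx, hzy, Ne.symm hzx, Ne.symm hzy]; ring
      simp only [R]
      rw [Finset.sum_congr rfl fun z _ => h2 z]
      simp [Finset.sum_add_distrib, Finset.mul_sum]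
    rw [h1, hD]
    by_cases hx : ξ x = 0
    · simp [L, hx]
    · obtain ⟨ζ, rfl⟩ : ∃ ζ, ξ = ζ + unitAt x := ⟨_, (sub_unitAt_add hx).symm⟩
      have h3 : ∀ z, D z = F (ζ + unitAt z + unitAt y) - F (ζ + unitAt x + unitAt z) := fun z => by
        simp only [D]
        rw [add_right_comm ζ, sub_unitAt_of_add]
      have h4 : annihilate a F (ζ + unitAt x - unitAt x + unitAt y) -
          annihilate a F (ζ + unitAt x) = ∑ z, (a z + ((ζ + unitAt x) z : ℕ)) * D z -
            F (ζ + unitAt x + unitAt y) + F (ζ + unitAt y + unitAt y) := by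
        have h5 : ∀ z, (a z + ((ζ + unitAt y) z : ℕ)) * F (ζ + unitAt y + unitAt z) -
            (a z + ((ζ + unitAt x) z : ℕ)) * F (ζ + unitAt x + unitAt z) =
            (a z + ((ζ + unitAt x) z : ℕ)) * D z -
              (if z = x then F (ζ + unitAt z + unitAt y) else 0) +
              (if z = y then F (ζ + unitAt z + unitAt y) else 0) := fun z => by
          rw [h3, add_right_comm ζ (unitAt y)]
          by_cases hzx : z = x
          · subst hzx; simp [hxy]; ring
          by_cases hzy : z = y
          · subst hzy; simp [hzx]; ring
          · simp [hzx, hzy]; ring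
        rw [sub_unitAt_of_add, annihilate, annihilate, ← Finset.sum_sub_distrib,
          Finset.sum_congr rfl fun z _ => h5 z]
        simp [Finset.sum_add_distrib]
      simp only [L, h4, h3 y]
      rw [add_right_comm ζ (unitAt x) (unitAt y)]
      ring
  have hT := G.sum_sum_eq_zero (T := fun x y => (a x + ξ x) * (a y + ξ y) *
    (F (ξ + unitAt y) - F (ξ + unitAt x))) fun x y => by ring
  rw [hR, ← add_zero (confGenerator G a (annihilate a F) ξ), ← hT, confGenerator,
    ← Finset.sum_add_distrib]
  refine Finset.sum_congr rfl fun x _ => ?_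
  rw [← Finset.sum_add_distrib]
  refine Finset.sum_congr rfl fun y _ => ?_
  by_cases hxy : x = y
  · subst hxy; simp [G.self]
  · rw [key x y hxy, ← mul_add]

/-- The lower bound for the non-zero eigenvalues. -/
theorem le_of_confGenerator_eq [Nontrivial V] (G : WeightedGraph V)
    (hG : G.toSimpleGraph.Connected) {β A : ℝ} {a : V → ℝ} (hβ : 0 < β) (ha : ∀ v, β ≤ a v)
    (hA : ∀ v, a v ≤ A) {l : ℝ} (hl : l ≠ 0) (k : ℕ) (F : (V → ℕ) → ℝ)
    (hF : ∃ η ∈ confs V k, F η ≠ 0) (heq : ∀ η ∈ confs V k, confGenerator G a F η = -l * F η) :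
    β ^ 2 * G.cMin ≤ A * ((Fintype.card V : ℝ) ^ 2 * G.toSimpleGraph.diam) * l := by
  induction k generalizing F with
  | zero =>
    obtain ⟨η, hη, hne⟩ := hF
    have h0 : η = 0 := by simpa [confs] using hη
    have h1 := heq η hη
    have h2 : confGenerator G a F η = 0 := by simp [confGenerator, h0]
    rw [h2] at h1
    exact absurd h1.symm (mul_ne_zero (neg_ne_zero.2 hl) hne)
  | succ k ih =>
    by_cases hann : ∃ ξ ∈ confs V k, annihilate a F ξ ≠ 0
    · refine ih (annihilate a F) hann fun ξ hξ => ?_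
      rw [confGenerator_annihilate, annihilate, annihilate, Finset.mul_sum]
      refine Finset.sum_congr rfl fun y _ => ?_
      rw [heq _ (add_unitAt_mem hξ y)]
      ring
    · push Not at hann
      have h1 := normSq_le_energy G hG hβ ha hA k hann
      have h2 : sipEnergy G a k F = l * normSq a (k + 1) F := by
        rw [← neg_neg (sipEnergy G a k F), ← sum_mul_confGenerator, normSq, Finset.mul_sum,
          ← Finset.sum_neg_distrib]
        refine Finset.sum_congr rfl fun η hη => ?_
        rw [heq η hη]
        ring
      have ha0 : ∀ v, 0 < a v := fun v => hβ.trans_le (ha v)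
      have h3 : 0 < normSq a (k + 1) F := by
        obtain ⟨η, hη, hne⟩ := hF
        exact Finset.sum_pos' (fun η _ => mul_nonneg (polyaWeight_pos ha0 η).le (sq_nonneg _))
          ⟨η, hη, mul_pos (polyaWeight_pos ha0 η) (by positivity)⟩
      rw [h2] at h1
      refine le_of_mul_le_mul_right ?_ h3
      linarith

/-- An eigenfunction of the random walk lifts to a linear eigenfunction of the particle system. -/
theorem confGenerator_linear (G : WeightedGraph V) {a g : V → ℝ} {l : ℝ}
    (hg : ∀ x, ∑ y, G.c x y * (a y * (g y - g x)) = -l * g x) (η : V → ℕ) :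
    confGenerator G a (fun η => ∑ v, η v * g v) η = -l * ∑ v, η v * g v := by
  -- The inclusion interaction contributes `η x * η y * (g y - g x)`, again antisymmetric; only the
  -- independent walks remain.
  have h1 : ∀ x y, η x * ((a y + η y) * (∑ v, ((η - unitAt x + unitAt y) v : ℕ) * g v -
      ∑ v, η v * g v)) = η x * (a y * (g y - g x)) + η x * η y * (g y - g x) := fun x y => by
    by_cases hx : η x = 0
    · simp [hx]
    · obtain ⟨ζ, rfl⟩ : ∃ ζ, η = ζ + unitAt x := ⟨_, (sub_unitAt_add hx).symm⟩
      rw [sub_unitAt_of_add]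
      have h2 : ∀ y, ∑ v, ((ζ + unitAt y) v : ℕ) * g v = ∑ v, ζ v * g v + g y := fun y => by
        simp [add_mul, Finset.sum_add_distrib, Pi.single_apply]
      rw [h2, h2]
      ring
  have h2 := G.sum_sum_eq_zero (T := fun x y => η x * η y * (g y - g x)) fun x y => by ring
  unfold confGenerator
  simp_rw [h1, mul_add, Finset.sum_add_distrib]
  rw [h2, add_zero, Finset.mul_sum]
  refine Finset.sum_congr rfl fun x _ => ?_
  rw [mul_left_comm, ← hg, Finset.mul_sum]
  exact Finset.sum_congr rfl fun y _ => by ring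

/-- The random walk on a connected graph has a non-zero eigenvalue. -/
theorem exists_walk_eigenfunction [Nontrivial V] (G : WeightedGraph V)
    (hG : G.toSimpleGraph.Connected) {a : V → ℝ} (ha : ∀ x, 0 < a x) :
    ∃ (l : ℝ) (g : V → ℝ), l ≠ 0 ∧ g ≠ 0 ∧
      ∀ x, ∑ y, G.c x y * (a y * (g y - g x)) = -l * g x := by
  -- The walk generator conjugated by `√a`, hence symmetric; as it is non-zero, it has a non-zero
  -- eigenvalue.
  let B : Matrix V V ℝ := Matrix.of (fun x y => √(a x) * √(a y) * G.c x y) -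
    Matrix.diagonal fun x => ∑ z, G.c x z * a z
  have hs : ∀ x, 0 < √(a x) := fun x => Real.sqrt_pos.2 (ha x)
  have hB : B.IsHermitian := by
    refine Matrix.IsHermitian.sub ?_ (Matrix.isHermitian_diagonal _)
    ext x y
    simp [G.symm x y, mul_comm]
  have hB0 : B ≠ 0 := by
    obtain ⟨x, y, h⟩ := G.exists_conductance_pos hG
    intro h0
    have hxy : x ≠ y := by rintro rfl; rw [G.self] at h; exact lt_irrefl _ h
    have h1 := congrFun (congrFun h0 x) y
    have h2 := mul_pos (mul_pos (hs x) (hs y)) h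
    have h3 : B x y = √(a x) * √(a y) * G.c x y := by simp [B, hxy]
    rw [← h3, h1] at h2
    exact lt_irrefl _ h2
  obtain ⟨v, t, ht, hv, hBv⟩ := hB.exists_eigenvector_of_ne_zero hB0
  refine ⟨-t, fun x => v x / √(a x), neg_ne_zero.2 ht, fun h => hv ?_, fun x => ?_⟩
  · funext x
    have := congrFun h x
    simpa [(hs x).ne'] using this
  · have h1 := congrFun hBv x
    rw [Matrix.sub_mulVec, Pi.sub_apply, Matrix.mulVec_diagonal, Matrix.mulVec, dotProduct] at h1
    simp only [Matrix.of_apply, Pi.smul_apply, smul_eq_mul] at h1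
    have hx := (hs x).ne'
    have h2 : ∑ y, √(a x) * √(a y) * G.c x y * v y =
        √(a x) * ∑ y, G.c x y * (a y * (v y / √(a y))) := by
      rw [Finset.mul_sum]
      refine Finset.sum_congr rfl fun y _ => ?_
      have hy := (hs y).ne'
      field_simp
      rw [Real.sq_sqrt (ha y).le]
      ring
    simp_rw [mul_sub, Finset.sum_sub_distrib]
    have h3 : ∑ y, G.c x y * (a y * (v x / √(a x))) = (∑ y, G.c x y * a y) * (v x / √(a x)) := by
      rw [Finset.sum_mul]
      exact Finset.sum_congr rfl fun y _ => by ring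
    rw [h3]
    rw [h2] at h1
    generalize ∑ y, G.c x y * (a y * (v y / √(a y))) = S at h1 ⊢
    generalize ∑ y, G.c x y * a y = T at h1 ⊢
    field_simp
    linarith

/-! ### From eigenfunctions to the spectral gap. -/

theorem sipGenerator_apply (G : WeightedGraph V) (a : V → ℝ) (k : ℕ) (F : (V → ℕ) → ℝ)
    (η : Config V k) :
    sipGenerator G a k (fun ξ => F ξ.1) η = confGenerator G a F η.1 := by
  simp only [sipGenerator, LinearMap.coe_mk, AddHom.coe_mk, confGenerator]
  refine Finset.sum_congr rfl fun x _ => Finset.sum_congr rfl fun y _ => ?_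
  by_cases hx : 0 < η.1 x
  · simp only [Config.move, hx, dif_pos]
    ring
  -- At an empty site truncated subtraction and `Config.move` may disagree, but the rate is zero.
  · have : η.1 x = 0 := by omega
    simp [this]

theorem exists_extension {k : ℕ} (f : Config V k → ℝ) :
    ∃ F : (V → ℕ) → ℝ, f = fun η => F η.1 :=
  ⟨fun η => if h : ∑ x, η x = k then f ⟨η, h⟩ else 0, by funext η; simp [η.2]⟩

theorem siteMin_le (a : V → ℝ) (x : V) : siteMin a ≤ a x :=
  ciInf_le (Set.finite_range _).bddBelow x

theorem le_siteMax (a : V → ℝ) (x : V) : a x ≤ siteMax a :=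
  le_ciSup (Set.finite_range _).bddAbove x

theorem siteMin_pos [Nonempty V] {a : V → ℝ} (ha : ∀ x, 0 < a x) : 0 < siteMin a := by
  obtain ⟨x, hx⟩ := exists_eq_ciInf_of_finite (f := a)
  rw [siteMin, ← hx]
  exact ha x

theorem le_of_hasEigenvalue [Nontrivial V] (G : WeightedGraph V)
    (hG : G.toSimpleGraph.Connected) {a : V → ℝ} (ha : ∀ x, 0 < a x) {k : ℕ} {l : ℝ} (hl : l ≠ 0)
    (h : Module.End.HasEigenvalue (-sipGenerator G a k) l) :
    siteMin a * (siteRatio a * (G.cMin / ((Fintype.card V : ℝ) ^ 2 * G.toSimpleGraph.diam))) ≤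
      l := by
  obtain ⟨f, hf⟩ := h.exists_hasEigenvector
  obtain ⟨F, rfl⟩ := exists_extension f
  have hβ := siteMin_pos ha
  obtain ⟨x⟩ := hG.nonempty
  have hA : 0 < siteMax a := (ha x).trans_le (le_siteMax a x)
  have hdiam : (0 : ℝ) < G.toSimpleGraph.diam :=
    Nat.cast_pos.2 (Nat.pos_of_ne_zero (SimpleGraph.connected_iff_diam_ne_zero.1 hG))
  have hcard : (0 : ℝ) < Fintype.card V := Nat.cast_pos.2 Fintype.card_pos
  have key := le_of_confGenerator_eq G hG hβ (siteMin_le a) (le_siteMax a) hl k F ?_ ?_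
  · rw [siteRatio, div_mul_div_comm, ← mul_div_assoc, div_le_iff₀ (by positivity)]
    linarith
  · obtain ⟨η, hη⟩ := Function.ne_iff.1 hf.2
    exact ⟨η.1, mem_confs.2 η.2, hη⟩
  · intro η hη
    have h1 := congrFun hf.apply_eq_smul ⟨η, mem_confs.1 hη⟩
    rw [LinearMap.neg_apply, Pi.neg_apply, sipGenerator_apply] at h1
    simp only [Pi.smul_apply, smul_eq_mul] at h1
    linarith

theorem hasEigenvalue_of_walk (G : WeightedGraph V) {a g : V → ℝ} {l : ℝ} (hg0 : g ≠ 0)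
    (hg : ∀ x, ∑ y, G.c x y * (a y * (g y - g x)) = -l * g x) {k : ℕ} (hk : k ≠ 0) :
    Module.End.HasEigenvalue (-sipGenerator G a k) l := by
  refine Module.End.hasEigenvalue_of_hasEigenvector
    (x := fun η : Config V k => ∑ v, (η.1 v : ℝ) * g v) ?_
  rw [Module.End.hasEigenvector_iff, Module.End.mem_eigenspace_iff]
  constructor
  · funext η
    rw [LinearMap.neg_apply, Pi.neg_apply,
      sipGenerator_apply G a k (fun ξ => ∑ v, (ξ v : ℝ) * g v), confGenerator_linear G hg]
    simp
  · obtain ⟨x, hx⟩ := Function.ne_iff.1 hg0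
    refine Function.ne_iff.2 ⟨⟨Pi.single x k, by simp⟩, ?_⟩
    simpa [Pi.single_apply, hk] using hx

theorem le_sipGap [Nontrivial V] (G : WeightedGraph V) (hG : G.toSimpleGraph.Connected)
    {a : V → ℝ} (ha : ∀ x, 0 < a x) :
    siteMin a * (siteRatio a * (G.cMin / ((Fintype.card V : ℝ) ^ 2 * G.toSimpleGraph.diam))) ≤
      sipGap G a := by
  have : Nonempty {k : ℕ // 2 ≤ k} := ⟨⟨2, le_rfl⟩⟩
  refine le_ciInf fun k => ?_
  -- The lifted walk eigenvalue shows that the set of non-zero eigenvalues is non-empty; otherwise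
  -- its `sInf` would be the default value 0.
  obtain ⟨l, g, hl, hg0, hg⟩ := exists_walk_eigenfunction G hG ha
  exact le_csInf ⟨l, hl, hasEigenvalue_of_walk G hg0 hg (by have := k.2; omega)⟩
    fun m hm => le_of_hasEigenvalue G hG ha hm.1 hm.2

theorem sipGap_le_of_walk [Nontrivial V] (G : WeightedGraph V) (hG : G.toSimpleGraph.Connected)
    {a g : V → ℝ} {l : ℝ} (ha : ∀ x, 0 < a x) (hl : l ≠ 0) (hg0 : g ≠ 0)
    (hg : ∀ x, ∑ y, G.c x y * (a y * (g y - g x)) = -l * g x) : sipGap G a ≤ l := by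
  have hmem : ∀ k : {k : ℕ // 2 ≤ k},
      l ∈ {l : ℝ | l ≠ 0 ∧ Module.End.HasEigenvalue (-sipGenerator G a k) l} := fun k =>
    ⟨hl, hasEigenvalue_of_walk G hg0 hg (by have := k.2; omega)⟩
  let B := siteMin a * (siteRatio a *
    (G.cMin / ((Fintype.card V : ℝ) ^ 2 * G.toSimpleGraph.diam)))
  have hlow : ∀ k : {k : ℕ // 2 ≤ k},
      B ∈ lowerBounds {l : ℝ | l ≠ 0 ∧ Module.End.HasEigenvalue (-sipGenerator G a k) l} :=
    fun k m hm => le_of_hasEigenvalue G hG ha hm.1 hm.2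
  have hbdd : BddBelow (Set.range fun k : {k : ℕ // 2 ≤ k} => sipGapK G a k) := by
    refine ⟨B, ?_⟩
    rintro _ ⟨k, rfl⟩
    exact le_csInf ⟨l, hmem k⟩ (hlow k)
  have hle : sipGap G a ≤ sipGapK G a 2 := ciInf_le hbdd ⟨2, le_refl 2⟩
  exact hle.trans (csInf_le ⟨B, hlow ⟨2, le_refl 2⟩⟩ (hmem ⟨2, le_refl 2⟩))

end Generator

/-! ### The two bounds of the theorem. -/

theorem theorem2p1 {V : Type*} [Fintype V] [DecidableEq V] [Nontrivial V]
    (G : WeightedGraph V) (hG : G.toSimpleGraph.Connected) :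
    (∀ α : V → ℝ, (∀ x, 0 < α x) →
      siteMin α * ((1 / 21) * (siteRatio α / (6 : ℝ) ^ (siteMin α / siteRatio α)) *
        (G.cMin / ((Fintype.card V : ℝ) ^ 2 * (G.toSimpleGraph.diam : ℝ)))) ≤ sipGap G α) ∧
    (∀ αhat : V → ℝ, (∀ x, 0 < αhat x) → ∃ C C' : ℝ, 0 < C ∧ 0 < C' ∧
      ∀ α : V → ℝ, (∀ x, 0 < α x) → siteMin α < 1 → (fun x => α x / siteMin α) = αhat →
        C * siteMin α ≤ sipGap G α ∧ sipGap G α ≤ C' * siteMin α) := by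
  have hc := G.cMin_pos hG
  have hdiam : (0 : ℝ) < G.toSimpleGraph.diam :=
    Nat.cast_pos.2 (Nat.pos_of_ne_zero (SimpleGraph.connected_iff_diam_ne_zero.1 hG))
  have hcard : (0 : ℝ) < Fintype.card V := Nat.cast_pos.2 Fintype.card_pos
  have hq : 0 < G.cMin / ((Fintype.card V : ℝ) ^ 2 * G.toSimpleGraph.diam) := by positivity
  obtain ⟨x₀⟩ := hG.nonempty
  have hmax : ∀ α : V → ℝ, (∀ x, 0 < α x) → 0 < siteMax α := fun α hα =>
    (hα x₀).trans_le (le_siteMax α x₀)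
  have hratio : ∀ α : V → ℝ, (∀ x, 0 < α x) → 0 < siteRatio α := fun α hα =>
    div_pos (siteMin_pos hα) (hmax α hα)
  refine ⟨fun α hα => ?_, fun αhat hhat => ?_⟩
  · refine le_trans ?_ (le_sipGap G hG hα)
    have hm := siteMin_pos hα
    have hr := hratio α hα
    have h6 : 1 ≤ (6 : ℝ) ^ (siteMin α / siteRatio α) :=
      Real.one_le_rpow (by norm_num) (by positivity)
    have h1 : siteRatio α / (6 : ℝ) ^ (siteMin α / siteRatio α) ≤ siteRatio α :=
      div_le_self hr.le h6
    have h2 : (1 / 21) * (siteRatio α / (6 : ℝ) ^ (siteMin α / siteRatio α)) ≤ siteRatio α := by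
      have : 0 ≤ siteRatio α / (6 : ℝ) ^ (siteMin α / siteRatio α) := by positivity
      linarith
    gcongr
  · obtain ⟨l, g, hl, hg0, hg⟩ := exists_walk_eigenfunction G hG hhat
    -- The sign of `l` follows from the gap itself, positive by the lower bound and at most `l`.
    have hlpos : 0 < l :=
      (mul_pos (siteMin_pos hhat) (mul_pos (hratio _ hhat) hq)).trans_le
        ((le_sipGap G hG hhat).trans (sipGap_le_of_walk G hG hhat hl hg0 hg))
    refine ⟨siteRatio αhat * (G.cMin / ((Fintype.card V : ℝ) ^ 2 * G.toSimpleGraph.diam)), l,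
      mul_pos (hratio _ hhat) hq, hlpos, fun α hα _ heq => ?_⟩
    have hm := siteMin_pos hα
    have hscale : ∀ x, α x = siteMin α * αhat x := fun x => by
      rw [← congrFun heq x]; field_simp
    have hmin : siteMin αhat = 1 := by
      have h1 : siteMin αhat = siteMin α * (siteMin α)⁻¹ := by
        simp_rw [← heq, div_eq_mul_inv]
        exact (Real.iInf_mul_of_nonneg (inv_nonneg.2 hm.le) α).symm
      rw [h1, mul_inv_cancel₀ hm.ne']
    constructor
    · have h1 := le_sipGap G hG hα
      have h2 : siteRatio α = siteRatio αhat := by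
        have h3 : siteMax αhat = siteMax α / siteMin α := by
          simp_rw [← heq, div_eq_mul_inv]
          exact (Real.iSup_mul_of_nonneg (inv_nonneg.2 hm.le) α).symm
        rw [siteRatio, siteRatio, hmin, h3, one_div_div]
      rw [h2] at h1
      linarith
    -- The same `g` serves all rescaled weights, with eigenvalue `l * siteMin α`.
    · refine sipGap_le_of_walk G hG hα (mul_ne_zero hl hm.ne') hg0 fun x => ?_
      have h1 := hg x
      have h2 : ∑ y, G.c x y * (α y * (g y - g x)) =
          siteMin α * ∑ y, G.c x y * (αhat y * (g y - g x)) := by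
        rw [Finset.mul_sum]
        refine Finset.sum_congr rfl fun y _ => ?_
        rw [hscale y]
        ring
      rw [h2, h1]
      ring
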